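/- Let $k\ge 1$, let $A$ be a $k\times k$ integer matrix, and let $d\le k$ be the degree of its minimal polynomial over $\mathbf{Q}$. Let $\lambda_1,\dots,\lambda_k\in\mathbf{C}$ be the eigenvalues of $A$, listed with algebraic multiplicity and ordered so that $\lambda_1,\dots,\lambda_d$ are the roots, with multiplicity, of the minimal polynomial. Assume that for every $i=1,\dots,k$ some power $\lambda_i^{l_i}$ with integer $l_i\ge 1$ is a positive integer, that $|\lambda_1|=1$, and that $|\lambda_i|>1$ for $i=2,\dots,d$. Let $\mu$ be a probability distribution on $\mathbf{Z}^k$ whose support is not parallel to any proper subspace of $\mathbf{Q}^k$ invariant under $A$; that is, there are no $A$-invariant subspace $W\subsetneq\mathbf{Q}^k$ and $v\in\mathbf{Q}^k$ with $\operatorname{supp}\mu\subset v+W$. Put $$V^{d-1}=\{A^m(\mathbf h-\mathbf h') : \mathbf h,\mathbf h'\in\operatorname{supp}\mu,\ m=0,1,\dots,d-1\}.$$ Then $V^{d-1}$ contains a basis of $\mathbf{Q}^k$. Moreover, for every integer matrix $B$ whose columns belong to $V^{d-1}$ and form a basis of $\mathbf{Q}^k$, there exist real numbers $\alpha,c>0$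 and $N\in\mathbf{N}$, depending only on $A$, $\mu$ and $B$, such that the following holds. Let $p>N$ be an integer with $\gcd(\det A,p)=\gcd(\det B,p)=1$, let $\mathbf{x}_0\in\mathbf{Z}^k$, let $\mathbf B_0,\mathbf B_1,\dots$ be independent random vectors with distribution $\mu$, and let $\mathbf{X}_0=\mathbf{x}_0$, $\mathbf{X}_{n+1}=A\mathbf{X}_n+\mathbf{B}_n \pmod p$. Let $P_n$ be the distribution of $\mathbf{X}_n$ on $\mathbf{Z}_p^k$ and $U$ the uniform distribution on $\mathbf{Z}_p^k$. Then for all integers $n\ge cp^2$, $$\|P_n-U\|=\frac12\sum_{\mathbf x\in\mathbf{Z}_p^k}|P_n(\mathbf x)-U(\mathbf x)|\le 2^{k-1}\exp\left(-\frac{\alpha n}{p^2}\right).$$ -/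

import Mathlib

open MeasureTheory ProbabilityTheory

namespace AffineChain

/-- The integer matrix `A`, viewed over a ring `R`. -/
def castMat (R : Type*) [Ring R] {k : ℕ} (A : Matrix (Fin k) (Fin k) ℤ) :
    Matrix (Fin k) (Fin k) R :=
  A.map (fun a => (a : R))

/-- The integer vector `x`, viewed over a ring `R`. For `R = ZMod p` this is reduction mod `p`. -/
def castVec (R : Type*) [Ring R] {k : ℕ} (x : Fin k → ℤ) : Fin k → R :=
  fun i => (x i : R)

/-- The degree `d` of the minimal polynomial (over `ℚ`) of the integer matrix `A`. -/
noncomputable def minDeg {k : ℕ} (A : Matrix (Fin k) (Fin k) ℤ) : ℕ :=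
  (minpoly ℚ (castMat ℚ A)).natDegree

/-- `lam 0, …, lam (k-1)` lists the complex eigenvalues of `A` with algebraic multiplicity, ordered
so that the first `d` of them are the roots of the minimal polynomial of `A`, with multiplicity
(`d` being its degree). -/
def IsEigenvalueList {k : ℕ} (A : Matrix (Fin k) (Fin k) ℤ) (lam : Fin k → ℂ) : Prop :=
  (castMat ℂ A).charpoly = ∏ i, (Polynomial.X - Polynomial.C (lam i)) ∧
  (minpoly ℚ (castMat ℚ A)).map (algebraMap ℚ ℂ) =
    ∏ i with i.val < minDeg A, (Polynomial.X - Polynomial.C (lam i))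

/-- The set `S` of integer vectors is parallel to the subspace `W` of `ℚ ^ k`:
it lies in some translate `v + W`. -/
def IsParallelTo {k : ℕ} (S : Set (Fin k → ℤ)) (W : Submodule ℚ (Fin k → ℚ)) : Prop :=
  ∃ v : Fin k → ℚ, ∀ x ∈ S, castVec ℚ x - v ∈ W

/-- `S` is parallel to some proper subspace of `ℚ ^ k` that is invariant under `A`. -/
def IsParallelToProperInvariant {k : ℕ} (A : Matrix (Fin k) (Fin k) ℤ)
    (S : Set (Fin k → ℤ)) : Prop :=
  ∃ W : Submodule ℚ (Fin k → ℚ),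
    W ≠ ⊤ ∧ (∀ w ∈ W, (castMat ℚ A).mulVec w ∈ W) ∧ IsParallelTo S W

/-- The set of differences of points of `S`. -/
def diffSet {k : ℕ} (S : Set (Fin k → ℤ)) : Set (Fin k → ℤ) :=
  {x | ∃ u ∈ S, ∃ v ∈ S, x = u - v}

/-- The vectors `A ^ m x`, with `x` a difference of points of `S` and `0 ≤ m ≤ d - 1`. -/
def orbitDiffSet {k : ℕ} (A : Matrix (Fin k) (Fin k) ℤ) (S : Set (Fin k → ℤ)) :
    Set (Fin k → ℤ) :=
  {y | ∃ x ∈ diffSet S, ∃ m < minDeg A, y = (A ^ m).mulVec x}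

/-- The columns of the integer matrix `B` belong to `orbitDiffSet A S` and form a basis
of `ℚ ^ k`. -/
def IsAdmissibleBasis {k : ℕ} (A : Matrix (Fin k) (Fin k) ℤ) (S : Set (Fin k → ℤ))
    (B : Matrix (Fin k) (Fin k) ℤ) : Prop :=
  (∀ j, B.col j ∈ orbitDiffSet A S) ∧
  LinearIndependent ℚ (fun j => castVec ℚ (B.col j)) ∧
  Submodule.span ℚ (Set.range fun j => castVec ℚ (B.col j)) = ⊤

/-- The chain `X (n+1) = A (X n) + b n` mod `p`, started at the reduction of `x₀`. -/
def chain {k : ℕ} {Ω : Type*} (A : Matrix (Fin k) (Fin k) ℤ) (p : ℕ) (x₀ : Fin k → ℤ)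
    (b : ℕ → Ω → Fin k → ℤ) : ℕ → Ω → Fin k → ZMod p
  | 0 => fun _ => castVec (ZMod p) x₀
  | n + 1 => fun ω =>
      (castMat (ZMod p) A).mulVec (chain A p x₀ b n ω) + castVec (ZMod p) (b n ω)

/-- `P_n(x) = Pr(X n = x)`. -/
noncomputable def chainLaw {k : ℕ} {Ω : Type*} [MeasurableSpace Ω] (Pr : Measure Ω)
    (A : Matrix (Fin k) (Fin k) ℤ) (p : ℕ) (x₀ : Fin k → ℤ) (b : ℕ → Ω → Fin k → ℤ) (n : ℕ)
    (x : Fin k → ZMod p) : ℝ :=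
  Pr.real {ω | chain A p x₀ b n ω = x}

/-- The uniform distribution on `(ℤ/p) ^ k`. -/
noncomputable def unif (k p : ℕ) (_x : Fin k → ZMod p) : ℝ := 1 / (p : ℝ) ^ k

/-- The variation distance `(1/2) ∑ |P x - Q x|` on `(ℤ/p) ^ k`. -/
noncomputable def varDist {k p : ℕ} [NeZero p] (P Q : (Fin k → ZMod p) → ℝ) : ℝ :=
  1 / 2 * ∑ x, |P x - Q x|

end AffineChain

/-! By Cauchy–Schwarz and Parseval (`varDist_unif_sq_le`), the squared distance is controlled by the
sum over `ξ ≠ 0` of the squared Fourier transform of `P_n`. By independence this transform has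
modulus equal to the product over `j < n` of the characteristic function of `μ` at `ξ A ^ j`
(`norm_fourier_chainLaw`). Two atoms of `μ` differing by `x` make a factor small unless `ξ ⬝ x` is
near `0` mod `p`. Since the columns of `B` have the form `A ^ m x`, the product is at most `exp (-(c
/ p²) ∑ energy)`, the energy being taken along the orbit of `det B • ξ`
(`exists_prod_norm_charSum_le`).

The arithmetic input is `absRep_dichotomy`. The eigenvalue of modulus one is `ε = ±1`, and the rest
of the minimal polynomial is expanding. A frequency orbit that stays near `0` for about `log p`
steps lifts to an integer orbit `z A ^ j`; then `z (A - ε)` lies in the expanding part yet stays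
bounded, so it is an integer vector of norm below `1`, hence zero, and `ξ A = ε ξ`. Such
eigenvectors have constant energy and contribute a Gaussian sum of order `exp (-γ n / p²)`. Every
other orbit leaves the neighbourhood of `0` once per `O(log p)` steps; there are at most `p ^ k` of
these, each contributing `exp (-κ n / log p)` for some `κ > 0`, which is negligible once `n ≥ p²`.
-/

namespace AffineChain

/-! ### Expanding operators: long bounded orbits start small. -/

section Expansion

open Polynomial

/-- If `T` is expanding on the kernel of `∏ (T - l)`, then a vector of this kernel whose orbit
stays bounded by `M` for a long time is small compared with `M`. -/
theorem exists_window_norm_le {E : Type*} [NormedAddCommGroup E] [NormedSpace ℂ E]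
    (T : E →L[ℂ] E) (s : Multiset ℂ) (hs : ∀ l ∈ s, 1 < ‖l‖) :
    ∀ ε : ℝ, 0 < ε → ∃ L : ℕ, ∀ w : E,
      aeval T (s.map fun l => (X - C l : ℂ[X])).prod w = 0 →
      ∀ M : ℝ, (∀ j ≤ L, ‖(T ^ j) w‖ ≤ M) → ‖w‖ ≤ ε * M := by
  induction s using Multiset.induction_on with
  | empty =>
    intro ε hε
    refine ⟨0, fun w hw M hM => ?_⟩
    have h0 : w = 0 := by simpa using hw
    have := hM 0 le_rfl
    subst h0
    simp only [map_zero, norm_zero] at this ⊢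
    positivity
  | cons l s ih =>
    intro ε hε
    have hl : 1 < ‖l‖ := hs l (Multiset.mem_cons_self l s)
    have hl0 : 0 < ‖l‖ := by linarith
    set r : ℝ := ‖l‖⁻¹ with hr
    have hr0 : 0 < r := inv_pos.2 hl0
    have hr1 : r < 1 := inv_lt_one_of_one_lt₀ hl
    have hrl : r * ‖l‖ = 1 := inv_mul_cancel₀ hl0.ne'
    obtain ⟨L₁, hL₁⟩ := exists_pow_lt_of_lt_one (half_pos hε) hr1
    set K : ℝ := ‖T‖ + ‖l‖ with hK
    have hK0 : 0 < K := by have := norm_nonneg T; linarith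
    -- Division by `K` cancels the bound `K * M` on the orbit of `w'`; the factor `‖l‖ - 1` is what
    -- the geometric series in `hstep` absorbs.
    obtain ⟨L₀, hL₀⟩ := ih (fun l hl => hs l (Multiset.mem_cons_of_mem hl))
      (ε / 2 * (‖l‖ - 1) / K) (by have : 0 < ‖l‖ - 1 := by linarith
                                  positivity)
    refine ⟨L₀ + L₁, fun w hw M hM => ?_⟩
    -- `(T - l) w` is killed by the remaining factors, so the induction hypothesis applies along its
    -- orbit.
    set w' : E := T w - l • w with hw'
    have hker : aeval T (s.map fun l => (X - C l : ℂ[X])).prod w' = 0 := by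
      rw [Multiset.map_cons, Multiset.prod_cons, mul_comm, map_mul] at hw
      rw [← hw, mul_apply_eq_comp]
      congr 1
      simp [hw', Algebra.algebraMap_eq_smul_one]
    have hcomm : ∀ j, (T ^ j) w' = (T ^ (j + 1)) w - l • (T ^ j) w := by
      intro j
      rw [hw', map_sub, map_smul, pow_succ, mul_apply_eq_comp]
    have hM' : ∀ j ≤ L₀ + L₁, ‖(T ^ j) w'‖ ≤ K * M := by
      intro j hj
      have h1 : (T ^ j) w' = T ((T ^ j) w) - l • (T ^ j) w := by
        rw [hcomm, pow_succ', mul_apply_eq_comp]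
      rw [h1, hK, add_mul]
      refine (norm_sub_le _ _).trans (add_le_add ?_ ?_)
      · exact (T.le_opNorm _).trans (mul_le_mul_of_nonneg_left (hM j hj) (norm_nonneg _))
      · rw [norm_smul]
        exact mul_le_mul_of_nonneg_left (hM j hj) (norm_nonneg _)
    have hsmall : ∀ i ≤ L₁, ‖(T ^ i) w'‖ ≤ ε / 2 * (‖l‖ - 1) * M := by
      intro i hi
      have := hL₀ ((T ^ i) w') ?_ (K * M) ?_
      · refine this.trans (le_of_eq ?_)
        field_simp
      · have hc : Commute (aeval T (s.map fun l => (X - C l : ℂ[X])).prod) (T ^ i) := by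
          have : T ^ i = aeval T (X ^ i : ℂ[X]) := by simp
          rw [this]
          exact Commute.map (Commute.all _ _) (aeval T)
        rw [← mul_apply_eq_comp, hc.eq, mul_apply_eq_comp, hker, map_zero]
      · intro j hj
        rw [← mul_apply_eq_comp, ← pow_add]
        exact hM' _ (by omega)
    have hM0 : 0 ≤ M := (norm_nonneg _).trans (hM 0 (Nat.zero_le _))
    -- Iterate `w = l⁻¹ (T w - w')`: the errors carry weights `r + ⋯ + r ^ i`, and `(‖l‖ - 1) (r + ⋯
    -- + r ^ i) = 1 - r ^ i`.
    have hstep : ∀ i ≤ L₁, ‖w‖ ≤ r ^ i * ‖(T ^ i) w‖ + ε / 2 * M * (1 - r ^ i) := by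
      intro i
      induction i with
      | zero => intro _; simp
      | succ i IH =>
        intro hi
        have h1 := IH (by omega)
        have h2 : ‖(T ^ i) w‖ ≤ r * (‖(T ^ (i + 1)) w‖ + ε / 2 * (‖l‖ - 1) * M) := by
          have h3 : l • (T ^ i) w = (T ^ (i + 1)) w - (T ^ i) w' := by rw [hcomm]; abel
          have h4 : ‖l‖ * ‖(T ^ i) w‖ ≤ ‖(T ^ (i + 1)) w‖ + ε / 2 * (‖l‖ - 1) * M := by
            rw [← norm_smul, h3]
            exact (norm_sub_le _ _).trans (add_le_add le_rfl (hsmall i (by omega)))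
          calc ‖(T ^ i) w‖ = r * (‖l‖ * ‖(T ^ i) w‖) := by rw [← mul_assoc, hrl, one_mul]
            _ ≤ _ := mul_le_mul_of_nonneg_left h4 hr0.le
        calc ‖w‖ ≤ r ^ i * ‖(T ^ i) w‖ + ε / 2 * M * (1 - r ^ i) := h1
          _ ≤ r ^ i * (r * (‖(T ^ (i + 1)) w‖ + ε / 2 * (‖l‖ - 1) * M))
              + ε / 2 * M * (1 - r ^ i) := by gcongr
          _ = r ^ (i + 1) * ‖(T ^ (i + 1)) w‖ + ε / 2 * M * (1 - r ^ (i + 1))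
              + r ^ i * (ε / 2 * M) * (r * ‖l‖ - 1) := by ring
          _ = _ := by rw [hrl]; ring
    have hfin := hstep L₁ le_rfl
    have h5 : r ^ L₁ * ‖(T ^ L₁) w‖ ≤ ε / 2 * M :=
      mul_le_mul hL₁.le (hM _ (by omega)) (norm_nonneg _) (by positivity)
    have h6 : ε / 2 * M * (1 - r ^ L₁) ≤ ε / 2 * M :=
      mul_le_of_le_one_right (by positivity) (by have := pow_pos hr0 L₁; linarith)
    linarith

/-- Each further window of length `L` gains a factor `1 / 2`. An orbit bounded by about `p` is thus
forced below norm `1` by a window of length `O(log p)`. -/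
theorem exists_window_norm_le_pow {E : Type*} [NormedAddCommGroup E] [NormedSpace ℂ E]
    (T : E →L[ℂ] E) (s : Multiset ℂ) (hs : ∀ l ∈ s, 1 < ‖l‖) :
    ∃ L : ℕ, ∀ (n : ℕ) (w : E),
      aeval T (s.map fun l => (X - C l : ℂ[X])).prod w = 0 →
      ∀ M : ℝ, (∀ j ≤ L * n, ‖(T ^ j) w‖ ≤ M) → ‖w‖ ≤ (1 / 2) ^ n * M := by
  obtain ⟨L, hL⟩ := exists_window_norm_le T s hs (1 / 2) (by norm_num)
  refine ⟨L, fun n => ?_⟩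
  induction n with
  | zero => intro w _ M hM; simpa using hM 0 le_rfl
  | succ n ih =>
    intro w hw M hM
    have := hL w hw ((1 / 2) ^ n * M) fun j hj => ih ((T ^ j) w) ?_ M ?_
    · rw [pow_succ']; linarith
    · have hc : Commute (aeval T (s.map fun l => (X - C l : ℂ[X])).prod) (T ^ j) := by
        have : T ^ j = aeval T (X ^ j : ℂ[X]) := by simp
        rw [this]
        exact Commute.map (Commute.all _ _) (aeval T)
      rw [← mul_apply_eq_comp, hc.eq, mul_apply_eq_comp, hw, map_zero]
    · intro i hi
      rw [← mul_apply_eq_comp, ← pow_add]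
      exact hM _ (by rw [mul_add]; omega)

end Expansion

/-! ### Orbits of frequencies modulo `p`: eigenvector or frequent escape. -/

section Dichotomy

open Polynomial Matrix

theorem aeval_transpose_eq {n R : Type*} [Fintype n] [DecidableEq n] [CommRing R]
    (A : Matrix n n R) (f : R[X]) : aeval Aᵀ f = (aeval A f)ᵀ := by
  simp [aeval_eq_sum_range, transpose_sum, transpose_smul, transpose_pow]

theorem castVec_vecMul (R : Type*) [CommRing R] {k : ℕ} (z : Fin k → ℤ)
    (A : Matrix (Fin k) (Fin k) ℤ) :
    castVec R (z ᵥ* A) = castVec R z ᵥ* castMat R A := by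
  ext i
  simp [castVec, castMat, vecMul, dotProduct]

theorem castMat_pow (R : Type*) [CommRing R] {k : ℕ} (A : Matrix (Fin k) (Fin k) ℤ) (n : ℕ) :
    castMat R (A ^ n) = castMat R A ^ n :=
  map_pow (RingHom.mapMatrix (Int.castRingHom R)) A n

/-- An integer vector, all of whose `A`-differences stay smaller than `2 ^ n` for a time
proportional to `n`, is an eigenvector. -/
theorem exists_vecMul_eq_of_small {k : ℕ} (A : Matrix (Fin k) (Fin k) ℤ) (ε : ℤ)
    (s : Multiset ℂ) (hs : ∀ l ∈ s, 1 < ‖l‖)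
    (hA : aeval (castMat ℂ A) ((X - C (ε : ℂ)) * (s.map fun l => (X - C l : ℂ[X])).prod) = 0) :
    ∃ L : ℕ, ∀ (n : ℕ) (z : Fin k → ℤ),
      (∀ j ≤ L * n, ∀ i, ((z ᵥ* A - ε • z) ᵥ* A ^ j) i < 2 ^ n ∧
        -2 ^ n < ((z ᵥ* A - ε • z) ᵥ* A ^ j) i) → z ᵥ* A = ε • z := by
  let φ : Matrix (Fin k) (Fin k) ℂ ≃ₐ[ℂ] ((Fin k → ℂ) →L[ℂ] (Fin k → ℂ)) :=
    (Matrix.toLinAlgEquiv').trans (Module.End.toContinuousLinearMap (Fin k → ℂ))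
  have hφ : ∀ M v, φ M v = M *ᵥ v := fun M v => rfl
  obtain ⟨L, hL⟩ := exists_window_norm_le_pow (φ (castMat ℂ A)ᵀ) s hs
  refine ⟨L, fun n z hz => ?_⟩
  set w : Fin k → ℤ := z ᵥ* A - ε • z with hw
  have hpow : ∀ j, ((φ (castMat ℂ A)ᵀ) ^ j) (castVec ℂ w) = castVec ℂ (w ᵥ* A ^ j) := by
    intro j
    rw [← map_pow, hφ, ← transpose_pow, mulVec_transpose, castVec_vecMul, castMat_pow]
  have hker : aeval (φ (castMat ℂ A)ᵀ) (s.map fun l => (X - C l : ℂ[X])).prod (castVec ℂ w) = 0 := by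
    rw [← AlgEquiv.coe_toAlgHom φ, aeval_algHom_apply, AlgEquiv.coe_toAlgHom, aeval_transpose_eq, hφ, mulVec_transpose]
    have h1 : castVec ℂ w = castVec ℂ z ᵥ* aeval (castMat ℂ A) (X - C (ε : ℂ)) := by
      have : castVec ℂ w = castVec ℂ (z ᵥ* A) - (ε : ℂ) • castVec ℂ z := by
        ext i; simp [castVec, hw]
      rw [this, castVec_vecMul, map_sub, aeval_X, aeval_C, vecMul_sub,
        Algebra.algebraMap_eq_smul_one, vecMul_smul, vecMul_one]
    rw [h1, vecMul_vecMul, ← map_mul, hA, vecMul_zero]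
  -- Integrality turns the strict bound into `2 ^ n - 1`, so that multiplying by `2⁻ⁿ` lands
  -- strictly below `1`, where only the zero integer vector lives.
  have hnorm : ∀ v : Fin k → ℤ, (∀ i, v i < 2 ^ n ∧ -2 ^ n < v i) → ‖castVec ℂ v‖ ≤ 2 ^ n - 1 := by
    intro v hv
    have h2 : (1 : ℝ) ≤ 2 ^ n := one_le_pow₀ (by norm_num)
    refine (pi_norm_le_iff_of_nonneg (by linarith)).2 fun i => ?_
    simp only [castVec, Complex.norm_intCast]
    obtain ⟨h3, h4⟩ := hv i
    have h5 : |v i| ≤ 2 ^ n - 1 := abs_le.2 ⟨by omega, by omega⟩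
    exact_mod_cast h5
  have hfin := hL n (castVec ℂ w) hker (2 ^ n - 1) fun j hj => by
    rw [hpow]
    exact hnorm _ (hz j hj)
  have h6 : ‖castVec ℂ w‖ < 1 := by
    refine hfin.trans_lt ?_
    rw [mul_sub, ← mul_pow]
    norm_num
  have h7 : w = 0 := by
    ext i
    have h8 : ‖castVec ℂ w i‖ < 1 := (norm_le_pi_norm _ i).trans_lt h6
    simp only [castVec, Complex.norm_intCast] at h8
    have h9 : |w i| < 1 := by exact_mod_cast h8
    simpa using h9
  exact sub_eq_zero.1 h7

/-- The absolute value of the representative of `t` in `(-p/2, p/2]`. -/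
def absRep {p : ℕ} (t : ZMod p) : ℕ := t.valMinAbs.natAbs

theorem absRep_neg {p : ℕ} (t : ZMod p) : absRep (-t) = absRep t := ZMod.natAbs_valMinAbs_neg t

theorem absRep_intCast_le {p : ℕ} [NeZero p] (n : ℤ) : absRep (n : ZMod p) ≤ n.natAbs := by
  refine ZMod.natAbs_min_of_le_div_two p _ _ (by simp) (ZMod.natAbs_valMinAbs_le _)

theorem absRep_eq_zero {p : ℕ} {t : ZMod p} : absRep t = 0 ↔ t = 0 := by
  simp [absRep]

theorem absRep_sum_mul_le {p : ℕ} [NeZero p] {ι : Type*} (s : Finset ι) (f : ι → ZMod p)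
    (a : ι → ℤ) :
    absRep (∑ i ∈ s, f i * (a i : ZMod p)) ≤ ∑ i ∈ s, absRep (f i) * (a i).natAbs := by
  have h : ∑ i ∈ s, f i * (a i : ZMod p) = ((∑ i ∈ s, (f i).valMinAbs * a i : ℤ) : ZMod p) := by
    simp only [Int.cast_sum, Int.cast_mul, ZMod.coe_valMinAbs]
  rw [h]
  refine (absRep_intCast_le _).trans ((Int.natAbs_sum_le _ _).trans (le_of_eq ?_))
  exact Finset.sum_congr rfl fun i _ => Int.natAbs_mul _ _

/-- Vectors with small representatives are moved by `A` as if they were integer vectors. -/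
theorem valMinAbs_vecMul_of_small {k p : ℕ} [NeZero p] (A : Matrix (Fin k) (Fin k) ℤ)
    (H : ℕ) (hH : 1 + ∑ i, ∑ j, (A i j).natAbs ≤ H) (η : Fin k → ZMod p)
    (h : ∀ i, 2 * H * absRep (η i) ≤ p) :
    (fun i => ((η ᵥ* castMat (ZMod p) A) i).valMinAbs) =
      (fun i => (η i).valMinAbs) ᵥ* A := by
  ext i
  rw [ZMod.valMinAbs_spec]
  constructor
  · simp only [vecMul, dotProduct, castMat, map_apply, Int.cast_sum, Int.cast_mul,
      ZMod.coe_valMinAbs]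
  · set y : ℤ := ((fun i => (η i).valMinAbs) ᵥ* A) i with hy
    have hp : 0 < p := NeZero.pos p
    have h1 : 2 * H * y.natAbs ≤ p * ∑ j, (A j i).natAbs := by
      calc 2 * H * y.natAbs ≤ 2 * H * ∑ j, absRep (η j) * (A j i).natAbs := by
            have h0 : y = ∑ j, (η j).valMinAbs * A j i := rfl
            rw [h0]
            refine Nat.mul_le_mul_left _ ((Int.natAbs_sum_le _ _).trans (le_of_eq ?_))
            exact Finset.sum_congr rfl fun j _ => Int.natAbs_mul _ _
        _ = ∑ j, (2 * H * absRep (η j)) * (A j i).natAbs := by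
            rw [Finset.mul_sum]
            exact Finset.sum_congr rfl fun j _ => by ring
        _ ≤ ∑ j, p * (A j i).natAbs :=
            Finset.sum_le_sum fun j _ => Nat.mul_le_mul_right _ (h j)
        _ = _ := by rw [Finset.mul_sum]
    -- The summand `1` in `H` makes this strict, which keeps the image strictly inside `(-p/2,
    -- p/2)`.
    have h2 : ∑ j, (A j i).natAbs < H := by
      refine lt_of_lt_of_le ?_ hH
      rw [Nat.lt_one_add_iff]
      exact Finset.sum_le_sum fun j _ =>
        Finset.single_le_sum (f := fun i => (A j i).natAbs) (fun _ _ => Nat.zero_le _)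
          (Finset.mem_univ i)
    have h3 : 2 * y.natAbs < p := by
      by_contra! hcon
      have h4 : H * p ≤ p * ∑ j, (A j i).natAbs := by
        refine le_trans ?_ h1
        rw [mul_comm 2 H, mul_assoc]
        exact Nat.mul_le_mul_left _ hcon
      rw [mul_comm] at h4
      exact absurd (Nat.le_of_mul_le_mul_left h4 hp) (by omega)
    constructor <;> omega

/-- The orbit of `ξ` under `A` modulo `p` has constant absolute representatives or leaves the
neighbourhood of `0` within every time window of length proportional to `log p`. -/
theorem absRep_dichotomy {k : ℕ} (A : Matrix (Fin k) (Fin k) ℤ) (ε : ℤ) (hε : ε = 1 ∨ ε = -1)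
    (s : Multiset ℂ) (hs : ∀ l ∈ s, 1 < ‖l‖)
    (hA : aeval (castMat ℂ A) ((X - C (ε : ℂ)) * (s.map fun l => (X - C l : ℂ[X])).prod) = 0) :
    ∃ H L : ℕ, 0 < H ∧ ∀ (p : ℕ) [NeZero p], IsUnit (castMat (ZMod p) A) →
      ∀ ξ : Fin k → ZMod p,
        (∀ j i, absRep ((ξ ᵥ* castMat (ZMod p) A ^ j) i) = absRep (ξ i)) ∨
        ∀ j₀, ∃ j, j₀ ≤ j ∧ j < j₀ + (L * p.size + 2) ∧
          ∃ i, p < 2 * H * absRep ((ξ ᵥ* castMat (ZMod p) A ^ j) i) := by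
  obtain ⟨L, hL⟩ := exists_vecMul_eq_of_small A ε s hs hA
  refine ⟨1 + ∑ i, ∑ j, (A i j).natAbs, L, by omega, fun p _ hu ξ => ?_⟩
  set H : ℕ := 1 + ∑ i, ∑ j, (A i j).natAbs with hH
  by_cases hcase : ∀ j₀, ∃ j, j₀ ≤ j ∧ j < j₀ + (L * p.size + 2) ∧
          ∃ i, p < 2 * H * absRep ((ξ ᵥ* castMat (ZMod p) A ^ j) i)
  · exact Or.inr hcase
  refine Or.inl ?_
  push Not at hcase
  obtain ⟨j₀, hj₀⟩ := hcase
  set z : ℕ → Fin k → ℤ := fun j i => ((ξ ᵥ* castMat (ZMod p) A ^ (j₀ + j)) i).valMinAbs with hz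
  have hzs : ∀ j < L * p.size + 2, z (j + 1) = z j ᵥ* A := by
    intro j hj
    have := valMinAbs_vecMul_of_small A H le_rfl (ξ ᵥ* castMat (ZMod p) A ^ (j₀ + j))
      (hj₀ _ (by omega) (by omega))
    rw [vecMul_vecMul, ← pow_succ] at this
    exact this
  have hzp : ∀ j ≤ L * p.size + 2, z j = z 0 ᵥ* A ^ j := by
    intro j
    induction j with
    | zero => intro _; simp
    | succ j ih => intro hj; rw [hzs j (by omega), ih (by omega), vecMul_vecMul, ← pow_succ]
  have hzb : ∀ j < L * p.size + 2, ∀ i, 2 * (z j i).natAbs ≤ p := by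
    intro j hj i
    have h1 := hj₀ (j₀ + j) (by omega) (by omega) i
    have h2 : 2 * absRep ((ξ ᵥ* castMat (ZMod p) A ^ (j₀ + j)) i) ≤ 
        2 * H * absRep ((ξ ᵥ* castMat (ZMod p) A ^ (j₀ + j)) i) := 
      Nat.mul_le_mul_right _ (by omega)
    exact h2.trans h1
  have heig : z 0 ᵥ* A = ε • z 0 := by
    -- The differences `z (j + 1) - ε z j` with `j ≤ L * p.size` involve times up to `L * p.size +
    -- 1`, hence the `+ 2` in the window; each is at most `p < 2 ^ p.size` in absolute value.
    refine hL p.size (z 0) fun j hj i => ?_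
    have h1 : (z 0 ᵥ* A - ε • z 0) ᵥ* A ^ j = z (j + 1) - ε • z j := by
      rw [sub_vecMul, vecMul_vecMul, ← pow_succ', smul_vecMul, ← hzp _ (by omega),
        ← hzp _ (by omega)]
    have h2 := hzb j (by omega) i
    have h3 := hzb (j + 1) (by omega) i
    have h4 : (p : ℤ) < 2 ^ p.size := by exact_mod_cast Nat.lt_size_self p
    rw [h1]
    simp only [Pi.sub_apply, Pi.smul_apply, smul_eq_mul]
    rcases hε with rfl | rfl <;> constructor <;> omega
  -- Invertibility of `A` mod `p` carries the eigenvector relation back from time `j₀` to `ξ`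
  -- itself.
  have hunit : ∀ j, IsUnit (castMat (ZMod p) A ^ j) := fun j => hu.pow j
  have hmod : ξ ᵥ* castMat (ZMod p) A = (ε : ZMod p) • ξ := by
    have h1 := congrArg (castVec (ZMod p)) heig
    have h2 : castVec (ZMod p) (z 0) = ξ ᵥ* castMat (ZMod p) A ^ j₀ := by
      ext i; simp [castVec, hz]
    have h3 : castVec (ZMod p) (ε • z 0) = (ε : ZMod p) • castVec (ZMod p) (z 0) := by
      ext i; simp [castVec]
    rw [castVec_vecMul, h3, h2, vecMul_vecMul, ← pow_succ, pow_succ', ← vecMul_vecMul,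
      ← smul_vecMul] at h1
    exact (vecMul_injective_of_isUnit (hunit j₀)) h1
  intro j
  have hj : ξ ᵥ* castMat (ZMod p) A ^ j = ((ε : ZMod p) ^ j) • ξ := by
    induction j with
    | zero => simp
    | succ j ih => rw [pow_succ, ← vecMul_vecMul, ih, smul_vecMul, hmod, smul_smul, pow_succ]
  intro i
  rw [hj]
  rcases hε with rfl | rfl
  · simp
  · rcases neg_one_pow_eq_or (ZMod p) j with h | h <;> simp [h, absRep_neg]

/-- Under the eigenvalue hypotheses, the minimal polynomial factors as `X ∓ 1` times a product of
expanding factors. -/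
theorem exists_expanding_factorization {k : ℕ} (hk : 0 < k) (A : Matrix (Fin k) (Fin k) ℤ)
    (lam : Fin k → ℂ) (hlam : IsEigenvalueList A lam) (hone : ‖lam ⟨0, hk⟩‖ = 1)
    (hgt : ∀ i : Fin k, 0 < i.val → i.val < minDeg A → 1 < ‖lam i‖) :
    ∃ ε : ℤ, (ε = 1 ∨ ε = -1) ∧ ∃ s : Multiset ℂ, (∀ l ∈ s, 1 < ‖l‖) ∧
      aeval (castMat ℂ A) ((X - C (ε : ℂ)) * (s.map fun l => (X - C l : ℂ[X])).prod) = 0 := by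
  have : NeZero k := ⟨hk.ne'⟩
  have hd : 0 < minDeg A := minpoly.natDegree_pos (Matrix.isIntegral _)
  have hm := hlam.2
  set F : Finset (Fin k) := {i | i.val < minDeg A} with hF
  have h0F : (⟨0, hk⟩ : Fin k) ∈ F := by simpa [hF] using hd
  -- The minimal polynomial is rational, so the conjugate of the first eigenvalue is also a root. It
  -- has modulus `1`, so it must be the first eigenvalue again, which is therefore real and equal to
  -- `±1`.
  have hconj : ∃ i ∈ F, (starRingEnd ℂ) (lam ⟨0, hk⟩) = lam i := by
    have h1 : ((minpoly ℚ (castMat ℚ A)).map (algebraMap ℚ ℂ)).eval (lam ⟨0, hk⟩) = 0 := by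
      rw [hm, eval_prod]
      exact Finset.prod_eq_zero h0F (by simp)
    have h2 : ((minpoly ℚ (castMat ℚ A)).map (algebraMap ℚ ℂ)).eval
        ((starRingEnd ℂ) (lam ⟨0, hk⟩)) = 0 := by
      have h3 := congrArg (starRingEnd ℂ) h1
      rw [eval_map, hom_eval₂, map_zero] at h3
      rw [eval_map, ← h3]
      congr 1
      exact Subsingleton.elim _ _
    rw [hm, eval_prod, Finset.prod_eq_zero_iff] at h2
    obtain ⟨i, hi, h3⟩ := h2
    exact ⟨i, hi, by simpa [sub_eq_zero] using h3⟩
  obtain ⟨ε, hε, hεl⟩ : ∃ ε : ℤ, (ε = 1 ∨ ε = -1) ∧ (ε : ℂ) = lam ⟨0, hk⟩ := by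
    obtain ⟨i, hi, h⟩ := hconj
    have h1 : ‖lam i‖ = 1 := by rw [← h, RCLike.norm_conj, hone]
    have h2 : i = ⟨0, hk⟩ := by
      by_contra hne
      have h3 : 0 < i.val := by
        rcases Nat.eq_zero_or_pos i.val with h4 | h4
        · exact absurd (Fin.ext h4) hne
        · exact h4
      have := hgt i h3 (by simpa [hF] using hi)
      linarith
    rw [h2] at h
    obtain ⟨r, hr⟩ := Complex.conj_eq_iff_real.1 h
    rw [hr, Complex.norm_real, Real.norm_eq_abs] at hone
    rcases eq_or_eq_neg_of_abs_eq hone with h | h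
    · exact ⟨1, Or.inl rfl, by rw [hr, h]; simp⟩
    · exact ⟨-1, Or.inr rfl, by rw [hr, h]; simp⟩
  refine ⟨ε, hε, (F.erase ⟨0, hk⟩).val.map lam, ?_, ?_⟩
  · intro l hl
    obtain ⟨i, hi, rfl⟩ := Multiset.mem_map.1 hl
    rw [Finset.mem_val, Finset.mem_erase] at hi
    refine hgt i ?_ (by simpa [hF] using hi.2)
    rcases Nat.eq_zero_or_pos i.val with h4 | h4
    · exact absurd (Fin.ext h4) hi.1
    · exact h4
  · have h1 : (X - C (ε : ℂ)) *
        (((F.erase ⟨0, hk⟩).val.map lam).map fun l => (X - C l : ℂ[X])).prod =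
        (minpoly ℚ (castMat ℚ A)).map (algebraMap ℚ ℂ) := by
      rw [hm, hεl, Multiset.map_map, ← Finset.mul_prod_erase F _ h0F]
      rfl
    have h2 : castMat ℂ A = (algebraMap ℚ ℂ).mapMatrix (castMat ℚ A) := by
      ext i j; simp [castMat]
    rw [h1, h2, ← map_aeval_eq_aeval_map, minpoly.aeval, map_zero]
    ext x i j
    by_cases h : i = j <;> simp [Matrix.algebraMap_eq_diagonal, h]

end Dichotomy

/-! ### Fourier analysis on `(ℤ/p) ^ k` and the transform of the chain. -/

section Fourier

open Matrix ZMod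

theorem norm_stdAddChar {p : ℕ} [NeZero p] (t : ZMod p) : ‖(stdAddChar t : ℂ)‖ = 1 := by
  rw [stdAddChar_apply, Circle.norm_coe]

theorem conj_stdAddChar {p : ℕ} [NeZero p] (t : ZMod p) :
    (starRingEnd ℂ) (stdAddChar t) = stdAddChar (-t) := by
  rw [AddChar.map_neg_eq_inv, Complex.inv_eq_conj (norm_stdAddChar t)]

theorem stdAddChar_sum {p : ℕ} [NeZero p] {ι : Type*} (s : Finset ι) (f : ι → ZMod p) :
    (stdAddChar (∑ i ∈ s, f i) : ℂ) = ∏ i ∈ s, stdAddChar (f i) := by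
  classical
  induction s using Finset.induction_on with
  | empty => simp
  | insert a s ha ih => rw [Finset.sum_insert ha, Finset.prod_insert ha, AddChar.map_add_eq_mul, ih]

theorem sum_stdAddChar_dotProduct {k p : ℕ} [NeZero p] (x : Fin k → ZMod p) :
    ∑ ξ : Fin k → ZMod p, (stdAddChar (ξ ⬝ᵥ x) : ℂ) = if x = 0 then (p : ℂ) ^ k else 0 := by
  have h1 : ∀ ξ : Fin k → ZMod p, (stdAddChar (ξ ⬝ᵥ x) : ℂ) = ∏ i, stdAddChar (ξ i * x i) := by
    intro ξ
    rw [dotProduct, stdAddChar_sum]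
  simp_rw [h1]
  rw [← Fintype.prod_sum (fun i t => (stdAddChar (t * x i) : ℂ))]
  simp_rw [AddChar.sum_mulShift _ (isPrimitive_stdAddChar p)]
  split_ifs with h
  · simp [h, ZMod.card]
  · obtain ⟨i, hi⟩ := Function.ne_iff.1 h
    exact Finset.prod_eq_zero (Finset.mem_univ i) (by rw [if_neg (by exact hi), Nat.cast_zero])

/-- Parseval's identity on `(ℤ/p) ^ k`. -/
theorem sum_normSq_fourier {k p : ℕ} [NeZero p] (f : (Fin k → ZMod p) → ℝ) :
    ∑ ξ : Fin k → ZMod p, ‖∑ x, (f x : ℂ) * stdAddChar (ξ ⬝ᵥ x)‖ ^ 2 =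
      (p : ℝ) ^ k * ∑ x, f x ^ 2 := by
  have h1 : ∀ ξ : Fin k → ZMod p,
      ((‖∑ x, (f x : ℂ) * stdAddChar (ξ ⬝ᵥ x)‖ ^ 2 : ℝ) : ℂ) =
        ∑ x, ∑ y, (f x : ℂ) * f y * stdAddChar (ξ ⬝ᵥ (x - y)) := by
    intro ξ
    push_cast
    rw [← Complex.mul_conj', map_sum, Finset.sum_mul_sum]
    refine Finset.sum_congr rfl fun x _ => Finset.sum_congr rfl fun y _ => ?_
    rw [map_mul, conj_stdAddChar, Complex.conj_ofReal, dotProduct_sub, sub_eq_add_neg,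
      AddChar.map_add_eq_mul]
    ring
  apply Complex.ofReal_injective
  rw [Complex.ofReal_sum]
  simp_rw [h1]
  rw [Finset.sum_comm, Complex.ofReal_mul, Complex.ofReal_sum, Finset.mul_sum]
  refine Finset.sum_congr rfl fun x _ => ?_
  rw [Finset.sum_comm]
  simp_rw [← Finset.mul_sum, sum_stdAddChar_dotProduct, sub_eq_zero]
  rw [Finset.sum_eq_single x (fun y _ hy => by rw [if_neg hy.symm, mul_zero]) (by simp)]
  push_cast
  rw [if_pos rfl]
  ring

/-- The upper bound lemma of Diaconis and Shahshahani for `(ℤ/p) ^ k`. -/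
theorem varDist_unif_sq_le {k p : ℕ} [NeZero p] (P : (Fin k → ZMod p) → ℝ) (hP : ∑ x, P x = 1) :
    4 * varDist P (unif k p) ^ 2 ≤
      ∑ ξ : Fin k → ZMod p with ξ ≠ 0, ‖∑ x, (P x : ℂ) * stdAddChar (ξ ⬝ᵥ x)‖ ^ 2 := by
  have hp : (p : ℝ) ≠ 0 := by exact_mod_cast NeZero.ne p
  have hpc : (p : ℂ) ≠ 0 := by exact_mod_cast NeZero.ne p
  set f : (Fin k → ZMod p) → ℝ := fun x => P x - unif k p x with hf
  have hcard : (Finset.univ : Finset (Fin k → ZMod p)).card = p ^ k := by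
    simp [ZMod.card]
  have h1 : 4 * varDist P (unif k p) ^ 2 ≤ (p : ℝ) ^ k * ∑ x, f x ^ 2 := by
    have := sq_sum_le_card_mul_sum_sq (s := Finset.univ) (f := fun x => |f x|)
    simp only [sq_abs, hcard] at this
    push_cast at this
    unfold varDist
    linarith
  -- The uniform law has zero transform off `0`; subtracting it from `P` therefore only removes the
  -- zero frequency.
  have hunif : ∀ ξ : Fin k → ZMod p, ξ ≠ 0 →
      ∑ x, (unif k p x : ℂ) * stdAddChar (ξ ⬝ᵥ x) = 0 := by
    intro ξ hξ
    simp only [unif, ← Finset.mul_sum]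
    simp_rw [dotProduct_comm ξ]
    rw [sum_stdAddChar_dotProduct, if_neg hξ, mul_zero]
  have h0 : ∑ x, f x = 0 := by
    simp only [hf, Finset.sum_sub_distrib, hP, unif, Finset.sum_const, hcard, nsmul_eq_mul]
    push_cast
    field_simp
    simp
  refine h1.trans ?_
  rw [← sum_normSq_fourier, ← Finset.sum_filter_add_sum_filter_not Finset.univ (fun ξ => ξ ≠ 0)]
  have h2 : ∑ ξ : Fin k → ZMod p with ¬ ξ ≠ 0, ‖∑ x, (f x : ℂ) * stdAddChar (ξ ⬝ᵥ x)‖ ^ 2 = 0 := by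
    refine Finset.sum_eq_zero fun ξ hξ => ?_
    have : ξ = 0 := by simpa using hξ
    subst this
    simp [← Complex.ofReal_sum, h0]
  rw [h2, add_zero]
  refine le_of_eq (Finset.sum_congr rfl fun ξ hξ => ?_)
  have hξ' : ξ ≠ 0 := by simpa using hξ
  congr 2
  rw [← sub_zero (∑ x, (P x : ℂ) * stdAddChar (ξ ⬝ᵥ x)), ← hunif ξ hξ', ← Finset.sum_sub_distrib]
  refine Finset.sum_congr rfl fun x _ => ?_
  simp only [hf]
  push_cast
  ring

/-- The characteristic function of `μ` at the frequency `ξ / p`. -/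
noncomputable def charSum {k : ℕ} (μ : PMF (Fin k → ℤ)) (p : ℕ) [NeZero p]
    (ξ : Fin k → ZMod p) : ℂ :=
  ∫ h, (stdAddChar (ξ ⬝ᵥ castVec (ZMod p) h) : ℂ) ∂μ.toMeasure

theorem norm_charSum_le_one {k : ℕ} (μ : PMF (Fin k → ℤ)) (p : ℕ) [NeZero p]
    (ξ : Fin k → ZMod p) : ‖charSum μ p ξ‖ ≤ 1 := by
  have := norm_integral_le_of_norm_le_const (μ := μ.toMeasure) (C := 1)
    (f := fun h => (stdAddChar (ξ ⬝ᵥ castVec (ZMod p) h) : ℂ))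
    (Filter.Eventually.of_forall fun h => (norm_stdAddChar _).le)
  simpa [charSum] using this

section Chain

variable {k p : ℕ} [NeZero p] {Ω : Type*}

theorem stdAddChar_dotProduct_chain (A : Matrix (Fin k) (Fin k) ℤ) (x₀ : Fin k → ℤ)
    (b : ℕ → Ω → Fin k → ℤ) (n : ℕ) (ω : Ω) (ξ : Fin k → ZMod p) :
    (stdAddChar (ξ ⬝ᵥ chain A p x₀ b n ω) : ℂ) =
      stdAddChar ((ξ ᵥ* castMat (ZMod p) A ^ n) ⬝ᵥ castVec (ZMod p) x₀) *
        ∏ j ∈ Finset.range n, stdAddChar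
          ((ξ ᵥ* castMat (ZMod p) A ^ (n - 1 - j)) ⬝ᵥ castVec (ZMod p) (b j ω)) := by
  induction n generalizing ξ with
  | zero => simp [chain]
  | succ n ih =>
    rw [Finset.prod_range_succ, chain, dotProduct_add, AddChar.map_add_eq_mul, dotProduct_mulVec,
      ih, vecMul_vecMul, ← pow_succ', mul_assoc]
    congr 2
    · refine Finset.prod_congr rfl fun j hj => ?_
      rw [vecMul_vecMul, ← pow_succ']
      congr 5
      have := Finset.mem_range.1 hj
      omega
    · simp

variable [MeasurableSpace Ω] {Pr : Measure Ω} {μ : PMF (Fin k → ℤ)} {b : ℕ → Ω → Fin k → ℤ}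

theorem aemeasurable_chain (hb : ∀ n, AEMeasurable (b n) Pr) (A : Matrix (Fin k) (Fin k) ℤ)
    (x₀ : Fin k → ℤ) (n : ℕ) : AEMeasurable (chain A p x₀ b n) Pr := by
  induction n with
  | zero => exact aemeasurable_const
  | succ n ih =>
    exact ((Measurable.of_discrete (f := (castMat (ZMod p) A).mulVec)).comp_aemeasurable ih).add
      ((Measurable.of_discrete (f := castVec (ZMod p))).comp_aemeasurable (hb n))

variable [IsProbabilityMeasure Pr]

theorem sum_chainLaw_mul_stdAddChar (hb : ∀ n, AEMeasurable (b n) Pr)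
    (A : Matrix (Fin k) (Fin k) ℤ) (x₀ : Fin k → ℤ) (n : ℕ) (ξ : Fin k → ZMod p) :
    ∑ x, (chainLaw Pr A p x₀ b n x : ℂ) * stdAddChar (ξ ⬝ᵥ x) =
      ∫ ω, (stdAddChar (ξ ⬝ᵥ chain A p x₀ b n ω) : ℂ) ∂Pr := by
  have hX := aemeasurable_chain (p := p) hb A x₀ n
  rw [← integral_map (f := fun x => (stdAddChar (ξ ⬝ᵥ x) : ℂ)) hX
    Measurable.of_discrete.aestronglyMeasurable, integral_fintype .of_finite]
  refine Finset.sum_congr rfl fun x _ => ?_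
  rw [map_measureReal_apply_of_aemeasurable hX (measurableSet_singleton x), Complex.real_smul]
  rfl

theorem sum_chainLaw (hb : ∀ n, AEMeasurable (b n) Pr) (A : Matrix (Fin k) (Fin k) ℤ)
    (x₀ : Fin k → ℤ) (n : ℕ) : ∑ x, chainLaw Pr A p x₀ b n x = 1 := by
  have h := sum_chainLaw_mul_stdAddChar (p := p) hb A x₀ n 0
  simp only [zero_dotProduct, AddChar.map_zero_eq_one, mul_one, integral_const, probReal_univ,
    one_smul] at h
  exact_mod_cast h

/-- Unrolled, `X_n` is `A ^ n x₀ + ∑ A ^ (n - 1 - j) b_j`. The starting point contributes a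
unimodular factor, and independence splits the expectation of the rest. -/
theorem norm_fourier_chainLaw (hi : iIndepFun b Pr) (hl : ∀ n, HasLaw (b n) μ.toMeasure Pr)
    (A : Matrix (Fin k) (Fin k) ℤ) (x₀ : Fin k → ℤ) (n : ℕ) (ξ : Fin k → ZMod p) :
    ‖∑ x, (chainLaw Pr A p x₀ b n x : ℂ) * stdAddChar (ξ ⬝ᵥ x)‖ =
      ∏ j ∈ Finset.range n, ‖charSum μ p (ξ ᵥ* castMat (ZMod p) A ^ j)‖ := by
  rw [sum_chainLaw_mul_stdAddChar (fun n => (hl n).aemeasurable)]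
  simp_rw [stdAddChar_dotProduct_chain]
  rw [integral_const_mul, norm_mul, norm_stdAddChar, one_mul]
  have h1 : ∫ ω, ∏ j ∈ Finset.range n, (stdAddChar
          ((ξ ᵥ* castMat (ZMod p) A ^ (n - 1 - j)) ⬝ᵥ castVec (ZMod p) (b j ω)) : ℂ) ∂Pr =
      ∏ j ∈ Finset.range n, charSum μ p (ξ ᵥ* castMat (ZMod p) A ^ (n - 1 - j)) := by
    simp_rw [Finset.prod_range]
    have h2 := (hi.precomp (g := fun j : Fin n => (j : ℕ)) Fin.val_injective).integral_fun_prod_comp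
      (f := fun (j : Fin n) (h : Fin k → ℤ) => (stdAddChar
          ((ξ ᵥ* castMat (ZMod p) A ^ (n - 1 - j)) ⬝ᵥ castVec (ZMod p) h) : ℂ))
      (fun j => (hl j).aemeasurable) (fun j => Measurable.of_discrete.aestronglyMeasurable)
    refine h2.trans (Finset.prod_congr rfl fun j _ => ?_)
    rw [charSum]
    exact (hl j).integral_comp (f := fun h : Fin k → ℤ => (stdAddChar
          ((ξ ᵥ* castMat (ZMod p) A ^ (n - 1 - j)) ⬝ᵥ castVec (ZMod p) h) : ℂ))
      Measurable.of_discrete.aestronglyMeasurable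
  rw [h1, norm_prod, ← Finset.prod_range_reflect]
  refine Finset.prod_congr rfl fun j hj => ?_
  have := Finset.mem_range.1 hj
  congr 4
  omega

end Chain

end Fourier

/-! ### Decay of the characteristic function along an orbit. -/

section CharacteristicFunction

open Matrix ZMod

/-- With `θ = 2πτ` and `|θ| ≤ π`, the bound `cos θ ≤ 1 - 2θ²/π² = 1 - 8τ²` gives `2 + 2 cos θ ≤ 4 -
16τ² ≤ (2 - 4τ²)²`. -/
theorem norm_one_add_stdAddChar_le {p : ℕ} [NeZero p] (t : ZMod p) :
    ‖(1 + stdAddChar t : ℂ)‖ ≤ 2 - 4 * ((absRep t : ℝ) / p) ^ 2 := by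
  have hp : (0 : ℝ) < p := by exact_mod_cast NeZero.pos p
  set m : ℤ := t.valMinAbs with hm
  set τ : ℝ := (absRep t : ℝ) / p with hτ
  have hτ0 : 0 ≤ τ := by positivity
  have hτh : τ ≤ 1 / 2 := by
    rw [hτ, div_le_iff₀ hp]
    have h1 : absRep t ≤ p / 2 := natAbs_valMinAbs_le t
    have h2 : 2 * absRep t ≤ p := by omega
    have h3 : (2 : ℝ) * absRep t ≤ p := by exact_mod_cast h2
    linarith
  set θ : ℝ := 2 * Real.pi * (m / p) with hθ
  have hmabs : |(m : ℝ)| = absRep t := by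
    rw [absRep, ← Int.cast_abs, Int.abs_eq_natAbs]; simp [hm]
  have hθabs : |θ| = 2 * Real.pi * τ := by
    rw [hθ, abs_mul, abs_div, hmabs, abs_of_pos hp, abs_of_pos (by positivity)]
  have hcos : Real.cos θ ≤ 1 - 8 * τ ^ 2 := by
    have h1 := Real.cos_le_one_sub_mul_cos_sq (x := θ)
      (by rw [hθabs]; nlinarith [Real.pi_pos])
    rw [← sq_abs θ, hθabs] at h1
    have h2 : 2 / Real.pi ^ 2 * (2 * Real.pi * τ) ^ 2 = 8 * τ ^ 2 := by
      field_simp [Real.pi_ne_zero]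
      ring
    rwa [h2] at h1
  have hchar : (stdAddChar t : ℂ) = Complex.exp (θ * Complex.I) := by
    rw [← coe_valMinAbs t, stdAddChar_coe]
    congr 1
    simp only [hθ, ← hm]
    push_cast
    ring
  have hsq : ‖(1 + stdAddChar t : ℂ)‖ ^ 2 = 2 + 2 * Real.cos θ := by
    rw [hchar, ← Complex.normSq_eq_norm_sq, Complex.normSq_apply]
    simp only [Complex.add_re, Complex.one_re, Complex.add_im, Complex.one_im,
      Complex.exp_ofReal_mul_I_re, Complex.exp_ofReal_mul_I_im]
    nlinarith [Real.sin_sq_add_cos_sq θ]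
  have h4 : 0 ≤ 2 - 4 * τ ^ 2 := by nlinarith
  refine abs_le_of_sq_le_sq' ?_ h4 |>.2
  rw [hsq]
  nlinarith [sq_nonneg (τ ^ 2)]

/-- An equal weight `m` is split off from both terms; cancellation is used only between these equal
parts. -/
theorem norm_mul_add_mul_stdAddChar_le {p : ℕ} [NeZero p] (s t : ZMod p) {a b m : ℝ}
    (hm : 0 ≤ m) (ha : m ≤ a) (hb : m ≤ b) :
    ‖(a * stdAddChar s + b * stdAddChar t : ℂ)‖ ≤
      a + b - 4 * m * ((absRep (s - t) : ℝ) / p) ^ 2 := by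
  have h1 : (a * stdAddChar s + b * stdAddChar t : ℂ) =
      m * (stdAddChar t * (1 + stdAddChar (s - t))) + (a - m : ℝ) * stdAddChar s +
        (b - m : ℝ) * stdAddChar t := by
    rw [mul_add, ← AddChar.map_add_eq_mul, add_sub_cancel]
    push_cast
    ring
  have h2 := norm_one_add_stdAddChar_le (s - t)
  rw [h1]
  refine (norm_add₃_le).trans ?_
  rw [norm_mul, norm_mul, norm_mul, norm_mul, norm_stdAddChar, norm_stdAddChar, Complex.norm_real,
    Complex.norm_real, Complex.norm_real, Real.norm_of_nonneg hm,
    Real.norm_of_nonneg (sub_nonneg.2 ha), Real.norm_of_nonneg (sub_nonneg.2 hb)]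
  nlinarith [mul_le_mul_of_nonneg_left h2 hm]

/-- Only the two atoms whose difference is `x` are allowed to cancel; the remaining mass is bounded
trivially, and `1 - t ≤ exp (-t)`. -/
theorem exists_norm_charSum_le_exp {k : ℕ} (μ : PMF (Fin k → ℤ)) {x : Fin k → ℤ}
    (hx : x ∈ diffSet μ.support) :
    ∃ c : ℝ, 0 < c ∧ ∀ (p : ℕ) [NeZero p] (ξ : Fin k → ZMod p),
      ‖charSum μ p ξ‖ ≤
        Real.exp (-(c * ((absRep (ξ ⬝ᵥ castVec (ZMod p) x) : ℝ) / p) ^ 2)) := by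
  obtain ⟨u, hu, v, hv, rfl⟩ := hx
  by_cases huv : u = v
  · refine ⟨1, one_pos, fun p _ ξ => ?_⟩
    have h0 : castVec (ZMod p) (u - v) = 0 := by ext i; simp [castVec, huv]
    rw [h0, dotProduct_zero]
    simpa [absRep] using norm_charSum_le_one μ p ξ
  have hpos : ∀ w ∈ μ.support, 0 < μ.toMeasure.real {w} := by
    intro w hw
    rw [measureReal_def, PMF.toMeasure_apply_singleton _ _ (measurableSet_singleton w)]
    exact ENNReal.toReal_pos ((PMF.mem_support_iff _ _).1 hw) (PMF.apply_ne_top _ _)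
  set a := μ.toMeasure.real {u} with ha
  set b := μ.toMeasure.real {v} with hb
  have hm : 0 < min a b := lt_min (hpos u hu) (hpos v hv)
  refine ⟨4 * min a b, by positivity, fun p _ ξ => ?_⟩
  set f : (Fin k → ℤ) → ℂ := fun h => stdAddChar (ξ ⬝ᵥ castVec (ZMod p) h) with hf
  have hint : Integrable f μ.toMeasure :=
    Integrable.of_bound Measurable.of_discrete.aestronglyMeasurable 1
      (Filter.Eventually.of_forall fun h => (norm_stdAddChar _).le)
  have hsplit := integral_add_compl (s := (({u, v} : Finset (Fin k → ℤ)) : Set (Fin k → ℤ)))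
    (Finset.measurableSet _) hint
  rw [setIntegral_finset _ hint.integrableOn, Finset.sum_pair huv] at hsplit
  have hs : μ.toMeasure.real (({u, v} : Finset (Fin k → ℤ)) : Set (Fin k → ℤ))ᶜ = 1 - (a + b) := by
    rw [probReal_compl_eq_one_sub (Finset.measurableSet _), ← sum_measureReal_singleton,
      Finset.sum_pair huv]
  have h1 := norm_setIntegral_le_of_norm_le_const (μ := μ.toMeasure) (f := f) (C := 1)
    (s := (({u, v} : Finset (Fin k → ℤ)) : Set (Fin k → ℤ))ᶜ) (measure_lt_top _ _)
    (fun h _ => (norm_stdAddChar _).le)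
  have h2 := norm_mul_add_mul_stdAddChar_le (ξ ⬝ᵥ castVec (ZMod p) u) (ξ ⬝ᵥ castVec (ZMod p) v)
    hm.le (min_le_left a b) (min_le_right a b)
  have h3 : ξ ⬝ᵥ castVec (ZMod p) u - ξ ⬝ᵥ castVec (ZMod p) v =
      ξ ⬝ᵥ castVec (ZMod p) (u - v) := by
    rw [← dotProduct_sub]; congr 1; ext i; simp [castVec]
  rw [h3] at h2
  rw [hs] at h1
  have h4 : ‖charSum μ p ξ‖ ≤
      1 - 4 * min a b * ((absRep (ξ ⬝ᵥ castVec (ZMod p) (u - v)) : ℝ) / p) ^ 2 := by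
    rw [charSum, ← hsplit]
    refine (norm_add_le _ _).trans ?_
    have h5 : a • f u + b • f v = (a * stdAddChar (ξ ⬝ᵥ castVec (ZMod p) u) +
        b * stdAddChar (ξ ⬝ᵥ castVec (ZMod p) v) : ℂ) := by simp [hf]
    rw [h5]
    linarith
  have h6 := Real.add_one_le_exp
    (-(4 * min a b * ((absRep (ξ ⬝ᵥ castVec (ZMod p) (u - v)) : ℝ) / p) ^ 2))
  linarith

/-- The squared length of the smallest representative of `ξ`. -/
noncomputable def energy {k p : ℕ} (ξ : Fin k → ZMod p) : ℝ := ∑ i, (absRep (ξ i) : ℝ) ^ 2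

theorem energy_nonneg {k p : ℕ} (ξ : Fin k → ZMod p) : 0 ≤ energy ξ :=
  Finset.sum_nonneg fun _ _ => sq_nonneg _

theorem exists_energy_vecMul_le {k : ℕ} (B : Matrix (Fin k) (Fin k) ℤ) :
    ∃ K : ℝ, 0 < K ∧ ∀ (p : ℕ) [NeZero p] (ξ : Fin k → ZMod p),
      energy (ξ ᵥ* castMat (ZMod p) B) ≤ K * energy ξ := by
  refine ⟨(∑ i, ∑ l, ((B i l).natAbs : ℝ) ^ 2) + 1,
    add_pos_of_nonneg_of_pos (by positivity) one_pos, fun p _ ξ => ?_⟩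
  have h1 : ∀ l, (absRep ((ξ ᵥ* castMat (ZMod p) B) l) : ℝ) ^ 2 ≤
      energy ξ * ∑ i, ((B i l).natAbs : ℝ) ^ 2 := by
    intro l
    have h2 : absRep ((ξ ᵥ* castMat (ZMod p) B) l) ≤ ∑ i, absRep (ξ i) * (B i l).natAbs :=
      absRep_sum_mul_le Finset.univ ξ fun i => B i l
    have h3 : (absRep ((ξ ᵥ* castMat (ZMod p) B) l) : ℝ) ≤
        ∑ i, (absRep (ξ i) : ℝ) * ((B i l).natAbs : ℝ) := by exact_mod_cast h2
    exact (pow_le_pow_left₀ (Nat.cast_nonneg _) h3 2).trans (Finset.sum_mul_sq_le_sq_mul_sq _ _ _)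
  calc energy (ξ ᵥ* castMat (ZMod p) B) ≤ ∑ l, energy ξ * ∑ i, ((B i l).natAbs : ℝ) ^ 2 :=
        Finset.sum_le_sum fun l _ => h1 l
    _ = (∑ i, ∑ l, ((B i l).natAbs : ℝ) ^ 2) * energy ξ := by
        rw [← Finset.mul_sum, Finset.sum_comm, mul_comm]
    _ ≤ _ := by nlinarith [energy_nonneg ξ]

/-- Pairing `ξ A ^ j` with `A ^ m x` is pairing `ξ A ^ (m + j)` with `x`, so only the factors `m, …,
m + n - 1` are needed. Taking `n + d` factors covers every `m < d` at once. -/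
theorem exists_prod_norm_charSum_le_of_column {k : ℕ} (A : Matrix (Fin k) (Fin k) ℤ)
    (μ : PMF (Fin k → ℤ)) {y : Fin k → ℤ} (hy : y ∈ orbitDiffSet A μ.support) :
    ∃ c : ℝ, 0 < c ∧ ∀ (p : ℕ) [NeZero p] (n : ℕ) (ξ : Fin k → ZMod p),
      ∏ j ∈ Finset.range (n + minDeg A), ‖charSum μ p (ξ ᵥ* castMat (ZMod p) A ^ j)‖ ≤
        Real.exp (-(c / (p : ℝ) ^ 2 * ∑ j ∈ Finset.range n,
          (absRep ((ξ ᵥ* castMat (ZMod p) A ^ j) ⬝ᵥ castVec (ZMod p) y) : ℝ) ^ 2)) := by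
  obtain ⟨x, hx, m, hm, rfl⟩ := hy
  obtain ⟨c, hc, h⟩ := exists_norm_charSum_le_exp μ hx
  refine ⟨c, hc, fun p _ n ξ => ?_⟩
  obtain ⟨r, hr⟩ := Nat.exists_eq_add_of_lt hm
  set g : ℕ → ℝ := fun j => ‖charSum μ p (ξ ᵥ* castMat (ZMod p) A ^ j)‖ with hg
  have hg0 : ∀ j, 0 ≤ g j := fun j => norm_nonneg _
  have hg1 : ∀ j, g j ≤ 1 := fun j => norm_charSum_le_one _ _ _
  have h1 : n + minDeg A = m + n + (r + 1) := by omega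
  rw [h1, Finset.prod_range_add, Finset.prod_range_add]
  have hb : ∏ j ∈ Finset.range n, g (m + j) ≤ Real.exp (-(c / (p : ℝ) ^ 2 * ∑ j ∈ Finset.range n,
          (absRep ((ξ ᵥ* castMat (ZMod p) A ^ j) ⬝ᵥ castVec (ZMod p) ((A ^ m).mulVec x)) : ℝ) ^ 2)) := by
    rw [Finset.mul_sum, ← Finset.sum_neg_distrib, Real.exp_sum]
    refine Finset.prod_le_prod (fun j _ => hg0 _) fun j _ => ?_
    have h2 : (ξ ᵥ* castMat (ZMod p) A ^ j) ⬝ᵥ castVec (ZMod p) ((A ^ m).mulVec x) =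
        (ξ ᵥ* castMat (ZMod p) A ^ (m + j)) ⬝ᵥ castVec (ZMod p) x := by
      have h3 : castVec (ZMod p) ((A ^ m).mulVec x) =
          (castMat (ZMod p) A ^ m) *ᵥ castVec (ZMod p) x := by
        rw [← castMat_pow]
        ext i
        simp [castVec, castMat, mulVec, dotProduct]
      rw [h3, dotProduct_mulVec, vecMul_vecMul, ← pow_add, add_comm]
    rw [h2]
    refine (h p _).trans (le_of_eq ?_)
    congr 1
    ring
  have h4 : ∏ j ∈ Finset.range m, g j ≤ 1 := Finset.prod_le_one (fun j _ => hg0 _) fun j _ => hg1 _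
  have h5 : ∏ j ∈ Finset.range (r + 1), g (m + n + j) ≤ 1 :=
    Finset.prod_le_one (fun j _ => hg0 _) fun j _ => hg1 _
  have h6 : 0 ≤ ∏ j ∈ Finset.range n, g (m + j) := Finset.prod_nonneg fun j _ => hg0 _
  have h7 : 0 ≤ ∏ j ∈ Finset.range m, g j := Finset.prod_nonneg fun j _ => hg0 _
  refine le_trans ?_ hb
  calc _ ≤ (∏ j ∈ Finset.range m, g j) * ∏ j ∈ Finset.range n, g (m + j) :=
        mul_le_of_le_one_right (mul_nonneg h7 h6) h5
    _ ≤ _ := mul_le_of_le_one_left h6 h4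

/-- The product obeys the bound of every column, so the column with the largest sum may be used; it
carries at least `1 / k` of the total. The identity `B * adj B = det B` recovers `det B • ξ` from
the pairings with an integer matrix, hence with a constant independent of `p`, which an inverse of
`B` mod `p` would not give. -/
theorem exists_prod_norm_charSum_le {k : ℕ} (hk : 0 < k) (A B : Matrix (Fin k) (Fin k) ℤ)
    (μ : PMF (Fin k → ℤ)) (hB : ∀ j, B.col j ∈ orbitDiffSet A μ.support) :
    ∃ c : ℝ, 0 < c ∧ ∀ (p : ℕ) [NeZero p] (n : ℕ) (ξ : Fin k → ZMod p),
      ∏ j ∈ Finset.range (n + minDeg A), ‖charSum μ p (ξ ᵥ* castMat (ZMod p) A ^ j)‖ ≤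
        Real.exp (-(c / (p : ℝ) ^ 2 * ∑ j ∈ Finset.range n,
          energy (((B.det : ZMod p) • ξ) ᵥ* castMat (ZMod p) A ^ j))) := by
  have : NeZero k := ⟨hk.ne'⟩
  choose c hc h using fun j => exists_prod_norm_charSum_le_of_column A μ (hB j)
  obtain ⟨K, hK, hE⟩ := exists_energy_vecMul_le B.adjugate
  obtain ⟨i₀, -, hi₀⟩ := Finset.exists_min_image Finset.univ c ⟨0, Finset.mem_univ _⟩
  refine ⟨c i₀ / (k * K), by have := hc i₀; positivity, fun p _ n ξ => ?_⟩
  set S : Fin k → ℝ := fun i => ∑ j ∈ Finset.range n,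
    (absRep ((ξ ᵥ* castMat (ZMod p) A ^ j) ⬝ᵥ castVec (ZMod p) (B.col i)) : ℝ) ^ 2 with hS
  have hS0 : ∀ i, 0 ≤ S i := fun i => Finset.sum_nonneg fun _ _ => sq_nonneg _
  have hsum : ∑ j ∈ Finset.range n, energy (((B.det : ZMod p) • ξ) ᵥ* castMat (ZMod p) A ^ j) ≤
      K * ∑ i, S i := by
    rw [Finset.sum_comm, Finset.mul_sum]
    refine Finset.sum_le_sum fun j _ => ?_
    set η := ξ ᵥ* castMat (ZMod p) A ^ j with hη
    have h1 : ((B.det : ZMod p) • ξ) ᵥ* castMat (ZMod p) A ^ j =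
        (η ᵥ* castMat (ZMod p) B) ᵥ* castMat (ZMod p) B.adjugate := by
      have h2 : castMat (ZMod p) B * castMat (ZMod p) B.adjugate =
          (B.det : ZMod p) • (1 : Matrix (Fin k) (Fin k) (ZMod p)) := by
        have h3 := congrArg (Int.castRingHom (ZMod p)).mapMatrix B.mul_adjugate
        rw [map_mul] at h3
        refine h3.trans ?_
        ext a b
        by_cases hab : a = b <;>
          simp only [RingHom.mapMatrix_apply, map_apply, Matrix.smul_apply, one_apply, smul_eq_mul, hab,
            if_true, if_false, mul_one, mul_zero, map_zero, eq_intCast]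
      rw [vecMul_vecMul, h2, vecMul_smul, vecMul_one, smul_vecMul]
    rw [h1]
    exact hE p _
  obtain ⟨i, -, hi⟩ := Finset.exists_max_image Finset.univ S ⟨0, Finset.mem_univ _⟩
  have hmax : ∑ i, S i ≤ k * S i := by
    have := Finset.sum_le_card_nsmul Finset.univ S (S i) hi
    simpa using this
  refine (h i p n ξ).trans (Real.exp_le_exp.2 (neg_le_neg ?_))
  have hp : (0 : ℝ) < p := by exact_mod_cast NeZero.pos p
  have hk' : (0 : ℝ) < k := by exact_mod_cast hk
  have hc0 := hc i₀
  calc c i₀ / (k * K) / (p : ℝ) ^ 2 * _ ≤ c i₀ / (k * K) / (p : ℝ) ^ 2 * (K * (k * S i)) := by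
        refine mul_le_mul_of_nonneg_left (hsum.trans ?_) (by positivity)
        exact mul_le_mul_of_nonneg_left hmax hK.le
    _ = c i₀ / (p : ℝ) ^ 2 * S i := by field_simp
    _ ≤ c i / (p : ℝ) ^ 2 * S i := by
        have := hi₀ i (Finset.mem_univ _)
        have := hS0 i
        gcongr

end CharacteristicFunction

/-! ### Summing the bounds over all nonzero frequencies. -/

section FrequencySums

open Matrix ZMod

/-- Two geometric series, one from each end of `{0, …, p - 1}`, give at most `(1 + r) / (1 - r)`,
which is at most `2` for `r ≤ 1 / 3`. -/
theorem sum_pow_absRep_le_two {p : ℕ} [NeZero p] {r : ℝ} (hr0 : 0 ≤ r) (hr : r ≤ 1 / 3) :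
    ∑ t : ZMod p, r ^ absRep t ≤ 2 := by
  have h1 : ∀ t : ZMod p, r ^ absRep t ≤ r ^ t.val + r ^ (p - t.val) := by
    intro t
    rw [absRep, valMinAbs_natAbs_eq_min]
    rcases min_choice t.val (p - t.val) with h | h <;> rw [h]
    · linarith [pow_nonneg hr0 (p - t.val)]
    · linarith [pow_nonneg hr0 t.val]
  have h2 : ∀ g : ℕ → ℝ, ∑ t : ZMod p, g t.val = ∑ i ∈ Finset.range p, g i := by
    intro g
    obtain ⟨n, rfl⟩ := Nat.exists_eq_succ_of_ne_zero (NeZero.ne p)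
    exact Fin.sum_univ_eq_sum_range g (n + 1)
  have h3 : ∑ i ∈ Finset.range p, r ^ (p - i) = r * ∑ i ∈ Finset.range p, r ^ i := by
    rw [← Finset.sum_range_reflect (fun i => r ^ i), Finset.mul_sum]
    refine Finset.sum_congr rfl fun i hi => ?_
    have := Finset.mem_range.1 hi
    rw [← pow_succ']
    congr 1
    omega
  have h4 : (∑ i ∈ Finset.range p, r ^ i) * (1 - r) ≤ 1 := by
    rw [geom_sum_mul_neg]
    linarith [pow_nonneg hr0 p]
  have h5 : 0 ≤ ∑ i ∈ Finset.range p, r ^ i := Finset.sum_nonneg fun i _ => pow_nonneg hr0 i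
  calc ∑ t : ZMod p, r ^ absRep t ≤ ∑ t : ZMod p, (r ^ t.val + r ^ (p - t.val)) :=
        Finset.sum_le_sum fun t _ => h1 t
    _ = (∑ i ∈ Finset.range p, r ^ i) * (1 + r) := by
        rw [h2 fun i => r ^ i + r ^ (p - i), Finset.sum_add_distrib, h3]; ring
    _ ≤ 2 := by nlinarith

theorem one_le_energy {k p : ℕ} {ξ : Fin k → ZMod p} (hξ : ξ ≠ 0) : 1 ≤ energy ξ := by
  obtain ⟨i, hi⟩ := Function.ne_iff.1 hξ
  have h1 : 1 ≤ absRep (ξ i) := Nat.one_le_iff_ne_zero.2 fun h => hi (absRep_eq_zero.1 h)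
  have h2 : (1 : ℝ) ≤ absRep (ξ i) := by exact_mod_cast h1
  have h3 := Finset.single_le_sum (f := fun i => (absRep (ξ i) : ℝ) ^ 2)
    (fun _ _ => sq_nonneg _) (Finset.mem_univ i)
  exact le_trans (by nlinarith) h3

theorem sum_absRep_le_energy {k p : ℕ} (ξ : Fin k → ZMod p) :
    ∑ i, (absRep (ξ i) : ℝ) ≤ energy ξ := by
  refine Finset.sum_le_sum fun i _ => ?_
  exact_mod_cast Nat.le_self_pow two_ne_zero (absRep (ξ i))

/-- Half of the exponent pays for `exp (-(a / 2))`, as the energy is at least `1`. The other half is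
at least `2 ∑ absRep (ξ i)`, so the sum factors over coordinates. -/
theorem sum_exp_neg_energy_le {k p : ℕ} [NeZero p] {a : ℝ} (ha : 4 ≤ a) :
    ∑ ξ : Fin k → ZMod p with ξ ≠ 0, Real.exp (-(a * energy ξ)) ≤
      2 ^ k * Real.exp (-(a / 2)) := by
  have hr : Real.exp (-2) ≤ 1 / 3 := by
    rw [Real.exp_neg, one_div]
    exact inv_anti₀ (by norm_num) (by linarith [Real.add_one_le_exp (2 : ℝ)])
  have h1 : ∀ ξ : Fin k → ZMod p, ξ ≠ 0 → Real.exp (-(a * energy ξ)) ≤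
      (∏ i, Real.exp (-2) ^ absRep (ξ i)) * Real.exp (-(a / 2)) := by
    intro ξ hξ
    simp_rw [← Real.exp_nat_mul]
    rw [← Real.exp_sum, ← Real.exp_add, Real.exp_le_exp, ← Finset.sum_mul]
    nlinarith [one_le_energy hξ, sum_absRep_le_energy ξ]
  calc _ ≤ ∑ ξ : Fin k → ZMod p with ξ ≠ 0,
          (∏ i, Real.exp (-2) ^ absRep (ξ i)) * Real.exp (-(a / 2)) :=
        Finset.sum_le_sum fun ξ hξ => h1 ξ (by simpa using hξ)
    _ ≤ ∑ ξ : Fin k → ZMod p, (∏ i, Real.exp (-2) ^ absRep (ξ i)) * Real.exp (-(a / 2)) :=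
        Finset.sum_le_sum_of_subset_of_nonneg (Finset.filter_subset _ _)
          fun ξ _ _ => by positivity
    _ = (∏ _i : Fin k, ∑ t : ZMod p, Real.exp (-2) ^ absRep t) * Real.exp (-(a / 2)) := by
        rw [← Finset.sum_mul, Fintype.prod_sum]
    _ ≤ _ := by
        gcongr
        rw [Finset.prod_const, Finset.card_univ, Fintype.card_fin]
        exact pow_le_pow_left₀ (Finset.sum_nonneg fun _ _ => by positivity)
          (sum_pow_absRep_le_two (by positivity) hr) k

theorem mul_le_sum_range_of_windows {f : ℕ → ℝ} (hf : ∀ j, 0 ≤ f j) {δ : ℝ} {W : ℕ}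
    (h : ∀ j₀, ∃ j, j₀ ≤ j ∧ j < j₀ + W ∧ δ ≤ f j) (n : ℕ) :
    (n / W : ℕ) * δ ≤ ∑ j ∈ Finset.range n, f j := by
  have key : ∀ q : ℕ, q * δ ≤ ∑ j ∈ Finset.range (W * q), f j := by
    intro q
    induction q with
    | zero => simp
    | succ q ih =>
      obtain ⟨j, hj1, hj2, hj3⟩ := h (W * q)
      rw [mul_add, mul_one, Finset.sum_range_add]
      have h1 := Finset.single_le_sum (f := fun i => f (W * q + i)) (fun i _ => hf _)
        (Finset.mem_range.2 (by omega : j - W * q < W))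
      have h2 : W * q + (j - W * q) = j := by omega
      simp only [h2] at h1
      push_cast
      linarith
  refine (key (n / W)).trans (Finset.sum_le_sum_of_subset_of_nonneg ?_ fun j _ _ => hf j)
  exact Finset.range_mono (Nat.mul_div_le n W)

/-- Splitting the sum over frequencies according to whether the orbit of `ξ` stays near `0`. -/
theorem sum_exp_neg_sum_energy_le {k p : ℕ} [NeZero p] (M : Matrix (Fin k) (Fin k) (ZMod p))
    {H W : ℕ} (hH : 0 < H)
    (hM : ∀ ξ : Fin k → ZMod p, (∀ j i, absRep ((ξ ᵥ* M ^ j) i) = absRep (ξ i)) ∨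
      ∀ j₀, ∃ j, j₀ ≤ j ∧ j < j₀ + W ∧ ∃ i, p < 2 * H * absRep ((ξ ᵥ* M ^ j) i))
    {γ : ℝ} (hγ : 0 < γ) (n : ℕ) (hn : 4 ≤ γ / (p : ℝ) ^ 2 * n) :
    ∑ ξ : Fin k → ZMod p with ξ ≠ 0,
        Real.exp (-(γ / (p : ℝ) ^ 2 * ∑ j ∈ Finset.range n, energy (ξ ᵥ* M ^ j))) ≤
      2 ^ k * Real.exp (-(γ / (p : ℝ) ^ 2 * n / 2)) +
        (p : ℝ) ^ k * Real.exp (-(γ / (4 * (H : ℝ) ^ 2) * (n / W : ℕ))) := by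
  have hp : (0 : ℝ) < p := by exact_mod_cast NeZero.pos p
  have hH' : (0 : ℝ) < H := by exact_mod_cast hH
  have h1 : ∀ ξ : Fin k → ZMod p,
      Real.exp (-(γ / (p : ℝ) ^ 2 * ∑ j ∈ Finset.range n, energy (ξ ᵥ* M ^ j))) ≤
        Real.exp (-(γ / (p : ℝ) ^ 2 * n * energy ξ)) +
          Real.exp (-(γ / (4 * (H : ℝ) ^ 2) * (n / W : ℕ))) := by
    intro ξ
    rcases hM ξ with h | h
    · have h2 : ∀ j, energy (ξ ᵥ* M ^ j) = energy ξ := fun j => by simp only [energy, h]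
      simp only [h2, Finset.sum_const, Finset.card_range, nsmul_eq_mul, ← mul_assoc]
      exact le_add_of_nonneg_right (Real.exp_nonneg _)
    · have h2 := mul_le_sum_range_of_windows (f := fun j => energy (ξ ᵥ* M ^ j))
        (fun j => energy_nonneg _) (δ := ((p : ℝ) / (2 * H)) ^ 2) (W := W) (fun j₀ => by
          obtain ⟨j, hj1, hj2, i, hi⟩ := h j₀
          refine ⟨j, hj1, hj2, le_trans ?_ (Finset.single_le_sum
            (f := fun i => (absRep ((ξ ᵥ* M ^ j) i) : ℝ) ^ 2) (fun _ _ => sq_nonneg _)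
            (Finset.mem_univ i))⟩
          have hi' : (p : ℝ) ≤ 2 * H * absRep ((ξ ᵥ* M ^ j) i) := by exact_mod_cast hi.le
          refine pow_le_pow_left₀ (by positivity) ?_ 2
          rw [div_le_iff₀ (by positivity)]
          linarith) n
      refine le_add_of_nonneg_of_le (Real.exp_nonneg _) (Real.exp_le_exp.2 (neg_le_neg ?_))
      calc γ / (4 * (H : ℝ) ^ 2) * (n / W : ℕ) =
            γ / (p : ℝ) ^ 2 * ((n / W : ℕ) * ((p : ℝ) / (2 * H)) ^ 2) := by field_simp; ring
        _ ≤ _ := mul_le_mul_of_nonneg_left h2 (by positivity)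
  refine (Finset.sum_le_sum fun ξ _ => h1 ξ).trans ?_
  rw [Finset.sum_add_distrib]
  refine add_le_add (sum_exp_neg_energy_le hn) ?_
  rw [Finset.sum_const, nsmul_eq_mul]
  refine mul_le_mul_of_nonneg_right ?_ (Real.exp_nonneg _)
  have h3 := Finset.card_filter_le (Finset.univ : Finset (Fin k → ZMod p)) (fun ξ => ξ ≠ 0)
  have h4 : (Finset.univ : Finset (Fin k → ZMod p)).card = p ^ k := by simp [ZMod.card]
  rw [h4] at h3
  exact_mod_cast h3

theorem exists_mul_log_add_le (a b : ℝ) {η : ℝ} (hη : 0 < η) :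
    ∃ N : ℕ, ∀ p : ℕ, N < p → a * Real.log p + b ≤ η * p := by
  have h1 : (fun x : ℝ => a * Real.log x + b) =o[Filter.atTop] (fun x : ℝ => x) :=
    (Real.isLittleO_log_id_atTop.const_mul_left a).add
      (Asymptotics.isLittleO_const_id_atTop b)
  have h2 := (h1.bound hη).natCast_atTop
  obtain ⟨N, hN⟩ := Filter.eventually_atTop.1 h2
  refine ⟨N, fun p hp => ?_⟩
  have := hN p hp.le
  rw [Real.norm_of_nonneg (Nat.cast_nonneg p)] at this
  exact (le_abs_self _).trans this

theorem size_le_two_mul_log_add_one {p : ℕ} (hp : 0 < p) :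
    (p.size : ℝ) ≤ 2 * Real.log p + 1 := by
  have h1 : 0 < p.size := Nat.size_pos.2 hp
  have h2 : 2 ^ (p.size - 1) ≤ p := Nat.lt_size.1 (by omega)
  have h3 : ((2 : ℝ) ^ (p.size - 1)) ≤ p := by exact_mod_cast h2
  have h4 := Real.log_le_log (by positivity) h3
  rw [Real.log_pow, Nat.cast_sub h1] at h4
  have h5 := Real.log_two_gt_d9
  have h6 : (1 : ℝ) ≤ p.size := by exact_mod_cast h1
  push_cast at h4
  nlinarith

/-- Absorbs the crude count `p ^ k` of escaping frequencies: for `n ≥ p²` the exponent, of order `n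
/ log p`, dominates both `k log p` and `n / p²`. -/
theorem exists_pow_mul_exp_le (k L : ℕ) {κ γ : ℝ} (hκ : 0 < κ) (hγ : 0 < γ) :
    ∃ N : ℕ, ∀ p : ℕ, N < p → ∀ n m : ℕ, (p : ℝ) ^ 2 ≤ n → (n : ℝ) ≤ 2 * m →
      (p : ℝ) ^ k * Real.exp (-(κ * (m / (L * p.size + 2) : ℕ))) ≤
        Real.exp (-(γ * n / (p : ℝ) ^ 2)) := by
  set η : ℝ := min 1 (κ / 2) with hη
  have hη0 : 0 < η := lt_min one_pos (by positivity)
  obtain ⟨N₁, hN₁⟩ := exists_mul_log_add_le (2 * L) (L + 2) hη0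
  obtain ⟨N₂, hN₂⟩ := exists_mul_log_add_le k (κ + γ) hη0
  refine ⟨max N₁ N₂, fun p hp n m hn hm => ?_⟩
  have hp0 : 0 < p := by omega
  have hp0' : (0 : ℝ) < p := by exact_mod_cast hp0
  have hlog : 0 ≤ Real.log p := Real.log_natCast_nonneg p
  set W : ℕ := L * p.size + 2 with hW
  have hW0 : (0 : ℝ) < W := by rw [hW]; positivity
  have hWp : (W : ℝ) ≤ η * p := by
    have h1 := size_le_two_mul_log_add_one hp0
    have h2 := hN₁ p (by omega)
    have h3 : (W : ℝ) = L * p.size + 2 := by rw [hW]; push_cast; ring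
    have h4 := mul_le_mul_of_nonneg_left h1 (Nat.cast_nonneg (α := ℝ) L)
    linarith
  have hC := hN₂ p (by omega)
  have hq : (m : ℝ) ≤ W * ((m / W : ℕ) + 1) := by
    have h1 := Nat.lt_mul_div_succ m (by omega : 0 < W)
    exact_mod_cast h1.le
  set q : ℝ := ((m / W : ℕ) : ℝ) with hqd
  -- The three terms pay for `p ^ k`, for the rounding in `m / W`, and for the target rate. Both `W`
  -- and `T` are at most `η p`, and `η² ≤ κ / 2`.
  set T : ℝ := k * Real.log p + (κ + γ) with hT
  have hT0 : 0 ≤ T := by positivity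
  have hWT : 2 * W * T ≤ κ * (p : ℝ) ^ 2 := by
    have h1 : (W : ℝ) * T ≤ (η * p) * (η * p) := mul_le_mul hWp hC hT0 (by positivity)
    have h2 : η * η ≤ κ / 2 * 1 :=
      mul_le_mul (min_le_right _ _) (min_le_left _ _) hη0.le (by positivity)
    nlinarith [mul_le_mul_of_nonneg_right h2 (sq_nonneg (p : ℝ))]
  have hp2 : (0 : ℝ) < (p : ℝ) ^ 2 := by positivity
  set s : ℝ := n / (p : ℝ) ^ 2 with hs
  have hs1 : 1 ≤ s := by rw [hs, le_div_iff₀ hp2]; linarith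
  have hns : (n : ℝ) = s * (p : ℝ) ^ 2 := by rw [hs]; field_simp
  have hmain : T * s ≤ κ * (q + 1) := by
    have h1 : 2 * W * (T * s) ≤ 2 * W * (κ * (q + 1)) := by
      calc 2 * W * (T * s) = (2 * W * T) * s := by ring
        _ ≤ κ * (p : ℝ) ^ 2 * s := mul_le_mul_of_nonneg_right hWT (by linarith)
        _ = κ * n := by rw [hns]; ring
        _ ≤ κ * (2 * m) := mul_le_mul_of_nonneg_left hm hκ.le
        _ ≤ κ * (2 * (W * (q + 1))) := by gcongr
        _ = _ := by ring
    exact le_of_mul_le_mul_left h1 (by positivity)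
  have hpk : (p : ℝ) ^ k = Real.exp (k * Real.log p) := by
    rw [Real.exp_nat_mul, Real.exp_log hp0']
  rw [hpk, ← Real.exp_add, Real.exp_le_exp]
  have h5 : γ * n / (p : ℝ) ^ 2 = γ * s := by rw [hs]; ring
  rw [h5]
  have h6 : (k : ℝ) * Real.log p * 1 ≤ k * Real.log p * s :=
    mul_le_mul_of_nonneg_left hs1 (by positivity)
  have h7 : κ * 1 ≤ κ * s := mul_le_mul_of_nonneg_left hs1 hκ.le
  nlinarith

end FrequencySums

/-! ### Existence of the basis and assembly of the bound. -/

section Convergence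

open Matrix ZMod Polynomial

theorem castVec_pow_mulVec {k : ℕ} (A : Matrix (Fin k) (Fin k) ℤ) (m : ℕ) (x : Fin k → ℤ) :
    castVec ℚ ((A ^ m).mulVec x) = (castMat ℚ A ^ m) *ᵥ castVec ℚ x := by
  rw [← castMat_pow]
  ext i
  simp [castVec, castMat, mulVec, dotProduct]

/-- Reducing `f` modulo the minimal polynomial leaves only powers of `A` below `d`. -/
theorem aeval_mulVec_mem_span {k : ℕ} (A : Matrix (Fin k) (Fin k) ℤ) (S : Set (Fin k → ℤ))
    {x : Fin k → ℤ} (hx : x ∈ diffSet S) (f : ℚ[X]) :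
    (aeval (castMat ℚ A) f) *ᵥ castVec ℚ x ∈ Submodule.span ℚ (castVec ℚ '' orbitDiffSet A S) := by
  have hmonic := minpoly.monic (Matrix.isIntegral (R := ℚ) (castMat ℚ A))
  rw [← aeval_modByMonic_eq_self_of_root (minpoly.aeval ℚ (castMat ℚ A))]
  set g := f %ₘ minpoly ℚ (castMat ℚ A) with hg
  by_cases hg0 : g = 0
  · simp [hg0]
  have hdeg : g.natDegree < minDeg A :=
    natDegree_lt_natDegree hg0 (degree_modByMonic_lt f hmonic)
  rw [aeval_eq_sum_range' hdeg, sum_mulVec]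
  refine Submodule.sum_mem _ fun i hi => ?_
  rw [smul_mulVec]
  refine Submodule.smul_mem _ _ (Submodule.subset_span ⟨(A ^ i).mulVec x, ?_, ?_⟩)
  · exact ⟨x, hx, i, Finset.mem_range.1 hi, rfl⟩
  · exact castVec_pow_mulVec A i x

/-- The span is `A`-invariant and contains all differences of points of `S`, so `S` lies in one of
its translates; were it proper, this would contradict `hS`. -/
theorem span_orbitDiffSet_eq_top {k : ℕ} (hk : 0 < k) (A : Matrix (Fin k) (Fin k) ℤ)
    {S : Set (Fin k → ℤ)} (hne : S.Nonempty) (hS : ¬ IsParallelToProperInvariant A S) :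
    Submodule.span ℚ (castVec ℚ '' orbitDiffSet A S) = ⊤ := by
  have : NeZero k := ⟨hk.ne'⟩
  by_contra hW
  refine hS ⟨_, hW, fun w hw => ?_, ?_⟩
  · induction hw using Submodule.span_induction with
    | mem w hw =>
      obtain ⟨_, ⟨x, hx, m, -, rfl⟩, rfl⟩ := hw
      have h1 := aeval_mulVec_mem_span A S hx (X ^ (m + 1))
      rw [map_pow, aeval_X, pow_succ', ← mulVec_mulVec, ← castVec_pow_mulVec] at h1
      exact h1
    | zero => simp
    | add v w _ _ hv hw => rw [mulVec_add]; exact Submodule.add_mem _ hv hw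
    | smul a v _ hv => rw [mulVec_smul]; exact Submodule.smul_mem _ _ hv
  · obtain ⟨u, hu⟩ := hne
    refine ⟨castVec ℚ u, fun x hx => ?_⟩
    have h1 := aeval_mulVec_mem_span A S (x := x - u) ⟨x, hx, u, hu, rfl⟩ 1
    rw [map_one, one_mulVec] at h1
    have h2 : castVec ℚ (x - u) = castVec ℚ x - castVec ℚ u := by ext i; simp [castVec]
    rwa [h2] at h1

theorem exists_isAdmissibleBasis {k : ℕ} (hk : 0 < k) (A : Matrix (Fin k) (Fin k) ℤ)
    {S : Set (Fin k → ℤ)} (hne : S.Nonempty) (hS : ¬ IsParallelToProperInvariant A S) :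
    ∃ B, IsAdmissibleBasis A S B := by
  have htop := span_orbitDiffSet_eq_top hk A hne hS
  obtain ⟨f, hf, hspan, hli⟩ := Submodule.exists_fun_fin_finrank_span_eq ℚ (castVec ℚ '' orbitDiffSet A S)
  have hfr : Module.finrank ℚ (Submodule.span ℚ (castVec ℚ '' orbitDiffSet A S)) = k := by
    rw [htop, finrank_top, Module.finrank_fin_fun]
  choose y hy hyf using hf
  set e : Fin k ≃ Fin (Module.finrank ℚ (Submodule.span ℚ (castVec ℚ '' orbitDiffSet A S))) :=
    finCongr hfr.symm with he
  have hcol : (fun j => castVec ℚ ((Matrix.of fun i j => y (e j) i).col j)) = f ∘ e := by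
    ext1 j
    exact hyf (e j)
  refine ⟨Matrix.of fun i j => y (e j) i, fun j => hy (e j), ?_, ?_⟩
  · rw [hcol]
    exact hli.comp _ e.injective
  · rw [hcol, e.surjective.range_comp, hspan, htop]

theorem isUnit_intCast_of_gcd_eq_one {p : ℕ} {n : ℤ} (h : Int.gcd n p = 1) :
    IsUnit (n : ZMod p) := by
  rw [ZMod.coe_int_isUnit_iff_isCoprime]
  exact (Int.isCoprime_iff_gcd_eq_one.2 h).symm

theorem isUnit_castMat {k p : ℕ} {A : Matrix (Fin k) (Fin k) ℤ} (h : Int.gcd A.det p = 1) :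
    IsUnit (castMat (ZMod p) A) := by
  rw [isUnit_iff_isUnit_det]
  have h1 : (castMat (ZMod p) A).det = (A.det : ZMod p) :=
    ((Int.castRingHom (ZMod p)).map_det A).symm
  rw [h1]
  exact isUnit_intCast_of_gcd_eq_one h

theorem exists_varDist_chainLaw_le {k : ℕ} (hk : 0 < k) (A B : Matrix (Fin k) (Fin k) ℤ)
    {μ : PMF (Fin k → ℤ)} (hB : ∀ j, B.col j ∈ orbitDiffSet A μ.support)
    (ε : ℤ) (hε : ε = 1 ∨ ε = -1) (s : Multiset ℂ) (hs : ∀ l ∈ s, 1 < ‖l‖)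
    (hA : aeval (castMat ℂ A) ((X - C (ε : ℂ)) * (s.map fun l => (X - C l : ℂ[X])).prod) = 0) :
    ∃ α c : ℝ, 0 < α ∧ 0 < c ∧ ∃ N : ℕ, ∀ (p : ℕ) [NeZero p], N < p →
        Int.gcd A.det (p : ℤ) = 1 → Int.gcd B.det (p : ℤ) = 1 →
        ∀ (Ω : Type*) [MeasurableSpace Ω] (Pr : Measure Ω) [IsProbabilityMeasure Pr]
          (b : ℕ → Ω → Fin k → ℤ), iIndepFun b Pr → (∀ n, HasLaw (b n) μ.toMeasure Pr) →
        ∀ (x₀ : Fin k → ℤ) (n : ℕ), c * (p : ℝ) ^ 2 ≤ (n : ℝ) →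
          varDist (chainLaw Pr A p x₀ b n) (unif k p) ≤
            2 ^ (k - 1) * Real.exp (-(α * n / (p : ℝ) ^ 2)) := by
  obtain ⟨c₁, hc₁, hdecay⟩ := exists_prod_norm_charSum_le hk A B μ hB
  obtain ⟨H, L, hH, hdich⟩ := absRep_dichotomy A ε hε s hs hA
  -- The factor `2` comes from squaring the transform.
  set γ : ℝ := 2 * c₁ with hγ
  have hγ0 : 0 < γ := by positivity
  have hH' : (0 : ℝ) < H := by exact_mod_cast hH
  obtain ⟨N, hN⟩ := exists_pow_mul_exp_le k L (κ := γ / (4 * (H : ℝ) ^ 2)) (γ := γ / 4)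
    (by positivity) (by positivity)
  -- Here `8 / γ` yields `γ m / p² ≥ 4`, the `+ 1` yields `n ≥ p²`, and `p > 2d` yields `m = n - d ≥
  -- n / 2`. The rate `γ / 2` in `m` becomes `γ / 4` in `n`, and the final square root halves it.
  refine ⟨γ / 8, 8 / γ + 1, by positivity, by positivity, max N (2 * minDeg A), ?_⟩
  intro p _ hp hAp hBp Ω _ Pr _ b hi hl x₀ n hn
  have hp0 : (0 : ℝ) < p := by exact_mod_cast NeZero.pos p
  have hp2 : (0 : ℝ) < (p : ℝ) ^ 2 := by positivity
  have hnp : (p : ℝ) ^ 2 ≤ n := by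
    have : 0 ≤ 8 / γ * (p : ℝ) ^ 2 := by positivity
    linarith
  have hnd : 2 * minDeg A ≤ n := by
    have h1 : p ^ 2 ≤ n := by exact_mod_cast hnp
    have h2 : p ≤ p ^ 2 := Nat.le_self_pow two_ne_zero p
    omega
  obtain ⟨m, rfl⟩ : ∃ m, n = m + minDeg A := ⟨n - minDeg A, by omega⟩
  have hnm : ((m + minDeg A : ℕ) : ℝ) ≤ 2 * m := by
    have : m + minDeg A ≤ 2 * m := by omega
    exact_mod_cast this
  set n := m + minDeg A with hn_def
  set W : ℕ := L * p.size + 2 with hW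
  have hBu := isUnit_intCast_of_gcd_eq_one hBp
  have hvd := varDist_unif_sq_le (chainLaw Pr A p x₀ b n)
    (sum_chainLaw (fun n => (hl n).aemeasurable) A x₀ n)
  set E : (Fin k → ZMod p) → ℝ := fun ξ => Real.exp (-(γ / (p : ℝ) ^ 2 *
    ∑ j ∈ Finset.range m, energy (ξ ᵥ* castMat (ZMod p) A ^ j))) with hE
  have hbound : ∀ ξ : Fin k → ZMod p,
      ‖∑ x, (chainLaw Pr A p x₀ b n x : ℂ) * stdAddChar (ξ ⬝ᵥ x)‖ ^ 2 ≤
        E ((B.det : ZMod p) • ξ) := by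
    intro ξ
    rw [norm_fourier_chainLaw hi hl]
    refine (pow_le_pow_left₀ (Finset.prod_nonneg fun _ _ => norm_nonneg _)
      (hdecay p m ξ) 2).trans (le_of_eq ?_)
    rw [← Real.exp_nat_mul]
    simp only [hE, hγ]
    congr 1
    push_cast
    ring
  -- As `det B` is a unit mod `p`, scaling by it permutes the nonzero frequencies.
  have hsubst : ∑ ξ : Fin k → ZMod p with ξ ≠ 0, E ((B.det : ZMod p) • ξ) =
      ∑ ξ : Fin k → ZMod p with ξ ≠ 0, E ξ := by
    obtain ⟨β, hβ⟩ := hBu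
    refine Finset.sum_equiv (MulAction.toPerm β) (fun ξ => ?_) fun ξ _ => ?_
    · simp [smul_eq_zero_iff_eq]
    · rw [MulAction.toPerm_apply, ← hβ]
      rfl
  have hquad : 4 ≤ γ / (p : ℝ) ^ 2 * m := by
    have h1 : (8 / γ) * (p : ℝ) ^ 2 ≤ 2 * m := by linarith
    have h2 : 8 / γ * (p : ℝ) ^ 2 * (γ / (p : ℝ) ^ 2) = 8 := by field_simp
    have h3 := mul_le_mul_of_nonneg_right h1 (by positivity : 0 ≤ γ / (p : ℝ) ^ 2)
    linarith
  have hsum := sum_exp_neg_sum_energy_le (castMat (ZMod p) A) (W := W) hH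
    (hdich p (isUnit_castMat hAp)) hγ0 m hquad
  have htail := hN p (by omega) n m hnp hnm
  have hgauss : Real.exp (-(γ / (p : ℝ) ^ 2 * m / 2)) ≤
      Real.exp (-(γ / 4 * n / (p : ℝ) ^ 2)) := by
    rw [Real.exp_le_exp, neg_le_neg_iff]
    calc γ / 4 * n / (p : ℝ) ^ 2 = γ / (p : ℝ) ^ 2 / 4 * n := by ring
      _ ≤ γ / (p : ℝ) ^ 2 / 4 * (2 * m) := mul_le_mul_of_nonneg_left hnm (by positivity)
      _ = _ := by ring
  set e : ℝ := Real.exp (-(γ / 4 * n / (p : ℝ) ^ 2)) with he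
  have he0 : 0 < e := Real.exp_pos _
  -- The two contributions merge because `2 ^ k + 1 ≤ 4 ^ k` for `k ≥ 1`; this is the source of the
  -- constant `2 ^ (k - 1)`.
  have htotal : 4 * varDist (chainLaw Pr A p x₀ b n) (unif k p) ^ 2 ≤ 4 ^ k * e := by
    have h1 : (2 : ℝ) ≤ 2 ^ k := by
      calc (2 : ℝ) = 2 ^ 1 := (pow_one 2).symm
        _ ≤ 2 ^ k := pow_le_pow_right₀ one_le_two hk
    have h2 : (4 : ℝ) ^ k = 2 ^ k * 2 ^ k := by rw [← mul_pow]; norm_num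
    calc _ ≤ ∑ ξ : Fin k → ZMod p with ξ ≠ 0, E ((B.det : ZMod p) • ξ) :=
          hvd.trans (Finset.sum_le_sum fun ξ _ => hbound ξ)
      _ ≤ 2 ^ k * e + e := by
          rw [hsubst]
          exact hsum.trans (add_le_add (by gcongr) htail)
      _ = (2 ^ k + 1) * e := by ring
      _ ≤ 4 ^ k * e := mul_le_mul_of_nonneg_right (by rw [h2]; nlinarith) he0.le
  have hsq : (2 ^ (k - 1) * Real.exp (-(γ / 8 * n / (p : ℝ) ^ 2))) ^ 2 * 4 = 4 ^ k * e := by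
    obtain ⟨r, rfl⟩ := Nat.exists_eq_succ_of_ne_zero hk.ne'
    have h1 : Real.exp (-(γ / 8 * n / (p : ℝ) ^ 2)) ^ 2 = e := by
      rw [← Real.exp_nat_mul, he]
      congr 1
      push_cast
      ring
    have h2 : (4 : ℝ) ^ (r + 1) = (2 ^ r) ^ 2 * 4 := by
      rw [pow_succ, ← pow_mul, mul_comm r, pow_mul]; norm_num
    rw [mul_pow, h1, Nat.succ_eq_add_one, h2, Nat.add_sub_cancel]
    ring
  exact (abs_le_of_sq_le_sq' (by linarith) (by positivity)).2

end Convergence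

end AffineChain

theorem theorem3p9 {k : ℕ} (hk : 0 < k) (A : Matrix (Fin k) (Fin k) ℤ)
    (lam : Fin k → ℂ) (hlam : AffineChain.IsEigenvalueList A lam)
    (hroot : ∀ i, ∃ l : ℕ, 0 < l ∧ ∃ m : ℕ, 0 < m ∧ lam i ^ l = (m : ℂ))
    (hone : ‖lam ⟨0, hk⟩‖ = 1)
    (hgt : ∀ i : Fin k, 0 < i.val → i.val < AffineChain.minDeg A → 1 < ‖lam i‖)
    (μ : PMF (Fin k → ℤ))
    (hμ : ¬ AffineChain.IsParallelToProperInvariant A μ.support) :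
    (∃ B, AffineChain.IsAdmissibleBasis A μ.support B) ∧
    ∀ B, AffineChain.IsAdmissibleBasis A μ.support B →
      ∃ α c : ℝ, 0 < α ∧ 0 < c ∧ ∃ N : ℕ, ∀ (p : ℕ) [NeZero p], N < p →
        Int.gcd A.det (p : ℤ) = 1 → Int.gcd B.det (p : ℤ) = 1 →
        ∀ (Ω : Type*) [MeasurableSpace Ω] (Pr : Measure Ω) [IsProbabilityMeasure Pr]
          (b : ℕ → Ω → Fin k → ℤ), iIndepFun b Pr → (∀ n, HasLaw (b n) μ.toMeasure Pr) →
        ∀ (x₀ : Fin k → ℤ) (n : ℕ), c * (p : ℝ) ^ 2 ≤ (n : ℝ) →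
          AffineChain.varDist (AffineChain.chainLaw Pr A p x₀ b n) (AffineChain.unif k p) ≤
            2 ^ (k - 1) * Real.exp (-(α * n / (p : ℝ) ^ 2)) := by
  refine ⟨AffineChain.exists_isAdmissibleBasis hk A μ.support_nonempty hμ, fun B hB => ?_⟩
  obtain ⟨ε, hε, s, hs, hA⟩ :=
    AffineChain.exists_expanding_factorization hk A lam hlam hone hgt
  exact AffineChain.exists_varDist_chainLaw_le hk A B hB.1 ε hε s hs hA
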